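/- **Theorem (entanglement-assisted codes from Euclidean BCH codes of extension degree 2 and length $q^2$).** Let $q$ be a prime power, let $\mathbb F_{q^2}/\mathbb F_q$ be the extension of finite fields of degree $2$, and let $n=q^2-1$, $\mathcal H=\{0,1,\dots,n-1\}$, identified with $\mathbb Z_n$. For $x\in\mathcal H$ let $I_x=\{xq^s \bmod n : s\ge 0\}$ be its cyclotomic coset and $i_x=\#I_x$, and let $m_0=0<m_1<\dots<m_z$ be the least elements of the distinct cyclotomic cosets. Let $0\le t<z$ and $\Delta=\Delta(t)=\bigcup_{j=0}^t I_{m_j}$. Let $D_\Delta\subseteq \mathbb F_{q^2}^{q^2}$ be the $\mathbb F_{q^2}$-linear code generated by the vectors $(P^i)_{P\in\mathbb F_{q^2}}$, $i\in\Delta$ (evaluation at all elements of $\mathbb F_{q^2}$, including $0$, with $0^0=1$), let $E_\Delta=D_\Delta\cap\mathbb F_q^{q^2}$ be the corresponding BCH code over $\mathbb F_q$, of length $q^2$, and let $C_\Delta=E_\Delta^{\perp}$ be its Euclidean dual. Write $m_t=b_0+b_1q$ with $0\le b_0,b_1<q$, and let $\delta=1$ if $q$ is odd and $m_t\ge (q^2-1)/2$,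 and $\delta=0$ otherwise. Put $$\begin{aligned} c={}&4\left(\frac{b_1(b_1+1)}{2}-\max\left\{0,b_1-\left\lceil\frac q2\right\rceil\right\}\left(b_1-\left\lfloor\frac q2\right\rfloor\right)+\max\{0,\,b_0-\max\{q-1-b_1,b_1\}+1\}\right)\\&-3\delta-2\max\left\{0,\left\lfloor\frac{m_t}{q+1}\right\rfloor-\left\lfloor\frac{q-1}2\right\rfloor\right\}-2\min\left\{\left\lfloor\frac{m_t}{q-1}\right\rfloor,\left\lfloor\frac q2\right\rfloor\right\}.\end{aligned}$$ Then $\dim_{\mathbb F_q} E_\Delta=\sum_{j=0}^t i_{m_j}$, $\;c=\dim E_\Delta-\dim(E_\Delta\cap C_\Delta)$, every nonzero word of $C_\Delta$ has Hamming weight at least $m_{t+1}+1$, and there is an entanglement-assisted quantum stabilizer code corresponding to $E_\Delta$ with parameters $$\left[\left[q^2,\;q^2-2\sum_{j=0}^t i_{m_j}+c,\;\ge m_{t+1}+1;\;c\right]\right]_q .$$ Here an $[[N,k,\ge d;c]]_q$ entanglement-assisted code encodes $k$ $q$-level systems isometrically into $N$ systems using $c$ maximally entangled pairs shared with the receiver,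 and detects every error acting on fewer than $d$ of the $N$ transmitted systems (for $k=0$ it is also required, as usual, to be pure to $d$: every operator acting on fewer than $d$ of the transmitted systems has the same expectation in the code state as in the maximally mixed state). It corresponds to $E_\Delta$ if its code space is the joint fixed space of operators that, up to scalars, are of the form $X(a)Z(b)$, $a,b\in E_\Delta$, on the transmitted systems tensored with some generalized Pauli operator $X(a')Z(b')$ on the receiver's halves of the pairs. -/

import Mathlib

open scoped Matrix Kronecker

namespace EABCH

/-! ### Cyclotomic cosets -/

/-- The minimal cyclotomic coset `I_x = {x q^s mod n : s ≥ 0}`, with `ℤ/n` identified with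
`{0, …, n - 1}`. -/
noncomputable def coset (n q x : ℕ) : Finset ℕ :=
  open Classical in (Finset.range n).filter (fun y => ∃ s : ℕ, y = x * q ^ s % n)

/-- The set `𝒜 ⊆ {0, …, n - 1}` of the least elements of the cyclotomic cosets. -/
noncomputable def minReps (n q : ℕ) : Finset ℕ :=
  open Classical in (Finset.range n).filter (fun x => ∀ y ∈ coset n q x, x ≤ y)

/-- `m_j`, the `j`-th element (counting from `0`) of `𝒜 = {m_0 = 0 < m_1 < ⋯ < m_z}` in increasing
order. It is meaningful for `j < #𝒜 = z + 1`. -/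
noncomputable def rep (n q j : ℕ) : ℕ :=
  Nat.nth (fun x => x ∈ minReps n q) j

/-- `Δ(t) = I_{m_0} ∪ ⋯ ∪ I_{m_t}`. -/
noncomputable def Delta (n q t : ℕ) : Finset ℕ :=
  (Finset.range (t + 1)).biUnion (fun j => coset n q (rep n q j))

/-! ### Codes -/

/-- The zero locus in a finite field `K` of `X ^ #K - X` is all of `K`; this is why the coordinates
of the codes below are indexed by the elements of `K`. -/
theorem zeroLocus_eq_univ (K : Type*) [Field K] [Fintype K] :
    {P : K | (Polynomial.X ^ Fintype.card K - Polynomial.X : Polynomial K).eval P = 0}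
      = Set.univ := by
  ext P
  simp [FiniteField.pow_card]

/-- The Reed-Solomon code `D_Δ ⊆ K^K`, of length `#K`, that is generated by the evaluations of the
monomials `X ^ i`, `i ∈ Δ`, at all the elements of `K` (the element `0` included). -/
noncomputable def rsCode (K : Type*) [Field K] (Δ : Finset ℕ) : Submodule K (K → K) :=
  Submodule.span K
    ((fun i : ℕ => fun P : K => (Polynomial.X ^ i : Polynomial K).eval P) '' (Δ : Set ℕ))

/-- The subfield subcode `D ∩ F^ι` of a code `D ⊆ K^ι`. -/
def subfieldSubcode (F : Type*) {K ι : Type*} [Field F] [Field K] [Algebra F K]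
    (D : Submodule K (ι → K)) : Submodule F (ι → F) :=
  (D.restrictScalars F).comap ((Algebra.linearMap F K).compLeft ι)

/-- The BCH code `E_Δ = D_Δ ∩ F^K` over `F`, of length `#K` (evaluation at `0` included). -/
noncomputable def bchCode (F K : Type*) [Field F] [Field K] [Algebra F K] (Δ : Finset ℕ) :
    Submodule F (K → F) :=
  subfieldSubcode F (rsCode K Δ)

/-- The Euclidean dual of a linear code. -/
def dualCode {F ι : Type*} [Field F] [Fintype ι] (E : Submodule F (ι → F)) :
    Submodule F (ι → F) :=
  E.orthogonalBilin (dotProductBilin F F)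

/-! ### Entanglement-assisted quantum codes

A system of `κ`-many qudits, each with basis labelled by `F`, has the state space
`(κ → F) → ℂ`, with its standard inner product. -/

/-- An entanglement-assisted quantum code with `q = #F` levels, which encodes `k` qudits into the
`#ι` qudits sent by the sender with the help of `c` maximally entangled pairs of qudits shared
beforehand. The encoder is an isometry from the `k` message qudits together with the sender's
halves of the `c` pairs to the `ι` qudits that go through the channel; equivalently, it is a
unitary applied after adjoining `#ι - k - c` ancilla qudits in a fixed pure state. -/
structure EACode (F ι : Type*) [Fintype F] [DecidableEq F] [Fintype ι] [DecidableEq ι]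
    (k c : ℕ) where
  encoder : Matrix (ι → F) ((Fin k → F) × (Fin c → F)) ℂ
  isometry : encoderᴴ * encoder = 1

namespace EACode

variable {F ι : Type*} [Fintype F] [DecidableEq F] [Fintype ι] [DecidableEq ι] {k c : ℕ}

/-- The encoded state of a message `ψ`: the encoder is applied to the message and to the sender's
halves of the maximally entangled state `q^(-c/2) ∑ₛ |s⟩ ⊗ |s⟩`, and the receiver's halves
(second component) are left untouched. -/
noncomputable def encode (Q : EACode F ι k c) :
    ((Fin k → F) → ℂ) →ₗ[ℂ] ((ι → F) × (Fin c → F) → ℂ) where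
  toFun ψ := fun p =>
    ((Real.sqrt ((Fintype.card F : ℝ) ^ c) : ℝ) : ℂ)⁻¹ *
      ∑ w : Fin k → F, Q.encoder p.1 (w, p.2) * ψ w
  map_add' ψ φ := by
    funext p
    simp only [Pi.add_apply, mul_add, Finset.sum_add_distrib]
  map_smul' a ψ := by
    funext p
    simp only [Pi.smul_apply, smul_eq_mul, RingHom.id_apply, Finset.mul_sum]
    exact Finset.sum_congr rfl fun w _ => by ring

/-- The space of all encoded states; it has dimension `q ^ k`. -/
noncomputable def codeSpace (Q : EACode F ι k c) : Submodule ℂ ((ι → F) × (Fin c → F) → ℂ) :=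
  LinearMap.range Q.encode

end EACode

/-- The operator `O` on the qudits `ι` acts on the qudits in `S` only: `O = A ⊗ 1` for an
operator `A` on the qudits in `S`. -/
def IsSupportedOn {F ι : Type*} [DecidableEq F] [Fintype ι] [DecidableEq ι] (S : Finset ι)
    (O : Matrix (ι → F) (ι → F) ℂ) : Prop :=
  ∃ A : Matrix (S → F) (S → F) ℂ, ∀ x y : ι → F,
    O x y = if ∀ i, i ∉ S → x i = y i then A (fun i => x i) (fun i => y i) else 0

/-- The minimum distance of the code is at least `d`: every error on fewer than `d` of the qudits
sent through the channel (the receiver's halves of the entangled pairs are error-free) is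
detectable in the sense of Knill and Laflamme. As this is void for a code of dimension one, for
`k = 0` the code is also asked to be pure, as usual: the
expectation of an operator on fewer than `d` qudits is the one in the maximally mixed state. -/
def EACode.MinDistGE {F ι : Type*} [Fintype F] [DecidableEq F] [Fintype ι] [DecidableEq ι]
    {k c : ℕ} (Q : EACode F ι k c) (d : ℕ) : Prop :=
  ∀ S : Finset ι, S.card < d → ∀ O : Matrix (ι → F) (ι → F) ℂ, IsSupportedOn S O →
    (∃ a : ℂ, ∀ u ∈ Q.codeSpace, ∀ v ∈ Q.codeSpace,
      star u ⬝ᵥ ((O ⊗ₖ (1 : Matrix (Fin c → F) (Fin c → F) ℂ)) *ᵥ v) = a * (star u ⬝ᵥ v)) ∧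
    (k = 0 → ∀ u ∈ Q.codeSpace,
      star u ⬝ᵥ ((O ⊗ₖ (1 : Matrix (Fin c → F) (Fin c → F) ℂ)) *ᵥ u)
        = O.trace / (Fintype.card (ι → F) : ℂ) * (star u ⬝ᵥ u))

/-- The generalized Pauli (Weyl) operator `X(a) Z(b)`, which sends the basis vector `|y⟩` to
`χ(b · y) |y + a⟩`, where `χ` is a primitive additive character of `F`. -/
noncomputable def weyl {F κ : Type*} [Field F] [Fintype F] [DecidableEq F] [Fintype κ]
    (a b : κ → F) : Matrix (κ → F) (κ → F) ℂ :=
  Matrix.of fun x y =>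
    if x = y + a then AddChar.FiniteField.primitiveChar_to_Complex F (b ⬝ᵥ y) else 0

/-- `Q` is an entanglement-assisted stabilizer code that corresponds to the linear code `E`: its
encoded states are exactly the states fixed by operators `S(a, b)`, `a, b ∈ E`, where `S(a, b)`
is, up to a scalar, `X(a) Z(b)` on the sender's qudits times some `X(a') Z(b')` on the receiver's
halves of the entangled pairs. -/
def EACode.IsStabilizerCodeOf {F ι : Type*} [Field F] [Fintype F] [DecidableEq F] [Fintype ι]
    [DecidableEq ι] {k c : ℕ} (Q : EACode F ι k c) (E : Submodule F (ι → F)) : Prop :=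
  ∃ (f g : (ι → F) → (ι → F) → (Fin c → F)) (μ : (ι → F) → (ι → F) → ℂ),
    ∀ u : (ι → F) × (Fin c → F) → ℂ, u ∈ Q.codeSpace ↔
      ∀ a ∈ E, ∀ b ∈ E, μ a b • ((weyl a b ⊗ₖ weyl (f a b) (g a b)) *ᵥ u) = u

end EABCH

/-! The quantum part works for any linear `E` of length N. Let R be the radical of E, the
intersection of E with its dual, and let P be the dual of R, which contains E. With c = dim E - dim
R, the quotient P/E has dimension k = N - 2 dim E + c. The dot product pairs E/R perfectly with P
modulo the dual of E, so there are coordinates β on E and α on P, with values in F^c, such that b·x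
+ β(b)·α(x) = 0 (`exists_symplectic_coordinates`). The receiver's Pauli operator for (a, b) is X(α
a)Z(β b). The Z-part forces a fixed state to live on the graph of α over P, and the X-part makes it
invariant under translations by (e, α e), e in E. Such states are functions on P/E, hence encode k
qudits.

For an error on a small set S, an off-diagonal term compares two points of the graph with the same
receiver label. They differ by a word of the dual of E supported on S, which is zero by the weight
bound. Diagonal entries depend only on the coordinates in S, onto which E projects surjectively, so
invariance replaces them by their mean (`star_dotProduct_mulVec_eq`). This gives detection and
purity at once.

For the BCH code, Frobenius stability of Δ gives dim E = #Δ by descent (`finrank_bchCode`). With n =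
#K - 1, the monomials of exponents i, j < n pair nontrivially only when i + j = n, so the radical is
again a BCH code and c counts the nonzero i in Δ with n - i in Δ (`bchCode_inf_dualCode`). The
exponents below m_{t+1} all lie in Δ, whence the BCH bound (`lt_hammingNorm_of_mem_dualCode`).

To count, write i = x + yq. Multiplication by q swaps the digits, negation complements them, and
membership in Δ is a lexicographic condition on (min, max) of the digits. The closed formula is then
a count of lattice points in a symmetric region (`card_filter_Delta_eq`). -/

namespace EABCH

/-! ### Euclidean duality. -/

section Dual

variable {F ι : Type*} [Field F] [Fintype ι]

theorem mem_dualCode {E : Submodule F (ι → F)} {y : ι → F} :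
    y ∈ dualCode E ↔ ∀ x ∈ E, x ⬝ᵥ y = 0 := Iff.rfl

theorem dualCode_eq_orthogonal (E : Submodule F (ι → F)) :
    dualCode E = LinearMap.BilinForm.orthogonal (dotProductBilin F F) E := rfl

theorem nondegenerate_dotProductBilin :
    LinearMap.BilinForm.Nondegenerate (dotProductBilin F F : LinearMap.BilinForm F (ι → F)) := by
  constructor
  · intro v hv
    exact dotProduct_eq_zero_iff.1 hv
  · intro v hv
    exact dotProduct_eq_zero_iff.1 fun w => (dotProduct_comm v w).trans (hv w)

theorem isRefl_dotProductBilin :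
    LinearMap.BilinForm.IsRefl (dotProductBilin F F : LinearMap.BilinForm F (ι → F)) :=
  fun v w h => (dotProduct_comm w v).trans h

theorem finrank_add_finrank_dualCode (E : Submodule F (ι → F)) :
    Module.finrank F E + Module.finrank F (dualCode E) = Fintype.card ι := by
  have h := LinearMap.BilinForm.finrank_orthogonal
    (nondegenerate_dotProductBilin (F := F) (ι := ι)) E
  have h' := Submodule.finrank_le E
  rw [dualCode_eq_orthogonal, h]
  rw [Module.finrank_fintype_fun_eq_card] at *
  omega

theorem dualCode_dualCode (E : Submodule F (ι → F)) : dualCode (dualCode E) = E :=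
  LinearMap.BilinForm.orthogonal_orthogonal nondegenerate_dotProductBilin
    isRefl_dotProductBilin E

theorem dualCode_anti {E E' : Submodule F (ι → F)} (h : E ≤ E') : dualCode E' ≤ dualCode E :=
  fun _ hy x hx => hy x (h hx)

end Dual

/-! ### Coordinates adapted to the radical of a code. -/

theorem finrank_map_add_finrank_ker_inf {F V W : Type*} [Field F] [AddCommGroup V] [Module F V]
    [FiniteDimensional F V] [AddCommGroup W] [Module F W] (f : V →ₗ[F] W) (P : Submodule F V) :
    Module.finrank F (P.map f) + Module.finrank F (LinearMap.ker f ⊓ P : Submodule F V)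
      = Module.finrank F P := by
  rw [← LinearMap.finrank_range_add_finrank_ker (f.domRestrict P), LinearMap.range_domRestrict,
    LinearMap.ker_domRestrict, inf_comm, ← Submodule.map_comap_subtype,
    Submodule.finrank_map_subtype_eq]

/-- For `E ≤ P` there are linear coordinates on `P` modulo `E`. -/
theorem exists_coordinates_mod {F V : Type*} [Field F] [AddCommGroup V] [Module F V]
    [FiniteDimensional F V] {E P : Submodule F V} (hEP : E ≤ P) {k : ℕ}
    (hk : Module.finrank F E + k = Module.finrank F P) :
    ∃ Φ : V →ₗ[F] (Fin k → F), (∀ x ∈ P, Φ x = 0 ↔ x ∈ E) ∧ ∀ w, ∃ x ∈ P, Φ x = w := by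
  have h1 : Module.finrank F (P.map E.mkQ) = k := by
    have h := finrank_map_add_finrank_ker_inf E.mkQ P
    rw [Submodule.ker_mkQ, inf_eq_left.2 hEP] at h
    omega
  have e : (P.map E.mkQ) ≃ₗ[F] (Fin k → F) :=
    LinearEquiv.ofFinrankEq _ _ (by rw [h1, Module.finrank_fin_fun])
  obtain ⟨g, hg⟩ := LinearMap.exists_extend e.toLinearMap
  have hg' : ∀ x (hx : x ∈ P), g (E.mkQ x) = e ⟨E.mkQ x, Submodule.mem_map_of_mem hx⟩ := by
    intro x hx
    exact LinearMap.congr_fun hg ⟨E.mkQ x, Submodule.mem_map_of_mem hx⟩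
  refine ⟨g ∘ₗ E.mkQ, ?_, ?_⟩
  · intro x hx
    rw [LinearMap.comp_apply, hg' x hx, LinearEquiv.map_eq_zero_iff, Submodule.mk_eq_zero,
      Submodule.mkQ_apply, Submodule.Quotient.mk_eq_zero]
  · intro w
    obtain ⟨x, hx, hxw⟩ := (e.symm w).2
    refine ⟨x, hx, ?_⟩
    rw [LinearMap.comp_apply, hg' x hx, ← e.apply_symm_apply w]
    congr 1
    exact Subtype.ext hxw

/-- The linear algebra behind the stabilizer code of `E`: coordinates `Φ`, `α` on the dual `P` of
the radical of `E`, and coordinates `β` on `E` modulo its radical that are dual to `α`. -/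
theorem exists_symplectic_coordinates {F ι : Type*} [Field F] [Fintype ι]
    (E : Submodule F (ι → F)) {k c : ℕ}
    (hc : Module.finrank F (E ⊓ dualCode E : Submodule F (ι → F)) + c = Module.finrank F E)
    (hk : k + 2 * Module.finrank F E = Fintype.card ι + c) :
    ∃ (P : Submodule F (ι → F)) (Φ : (ι → F) →ₗ[F] (Fin k → F))
      (α β : (ι → F) →ₗ[F] (Fin c → F)),
      E ≤ P ∧ (∀ x ∈ P, Φ x = 0 ↔ x ∈ E) ∧ (∀ w s, ∃ x ∈ P, Φ x = w ∧ α x = s) ∧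
      (∀ x ∈ P, α x = 0 → x ∈ dualCode E) ∧
      (∀ x s, (∀ b ∈ E, b ⬝ᵥ x + β b ⬝ᵥ s = 0) ↔ x ∈ P ∧ α x = s) := by
  classical
  set R : Submodule F (ι → F) := E ⊓ dualCode E with hR
  have hEP : E ≤ dualCode R := by
    intro x hx r hr
    exact (dotProduct_comm r x).trans (hr.2 x hx)
  have hRd := finrank_add_finrank_dualCode R
  obtain ⟨Φ, hΦ, hΦs⟩ := exists_coordinates_mod hEP (k := k) (by omega)
  obtain ⟨β, hβ, hβs⟩ := exists_coordinates_mod (inf_le_left : R ≤ E) (k := c) hc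
  choose w hwE hw using fun j : Fin c => hβs (Pi.single j 1)
  -- The `w j` lift the standard basis along β. The sign makes the phase b·x + β(b)·α(x) vanish.
  let α : (ι → F) →ₗ[F] (Fin c → F) := LinearMap.pi fun j => -(dotProductBilin F F (w j))
  have hα : ∀ x j, α x j = -(w j ⬝ᵥ x) := fun x j => rfl
  have key : ∀ b ∈ E, ∀ x ∈ dualCode R, b ⬝ᵥ x = -(β b ⬝ᵥ α x) := by
    intro b hb x hx
    have hsum : ∑ j, β b j • w j ∈ E := Submodule.sum_mem _ fun j _ => E.smul_mem _ (hwE j)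
    have h0 : b - ∑ j, β b j • w j ∈ R := by
      refine (hβ _ (E.sub_mem hb hsum)).1 ?_
      rw [map_sub, map_sum, sub_eq_zero]
      funext i
      simp [hw, Pi.single_apply]
    have h1 := hx _ h0
    change (b - ∑ j, β b j • w j) ⬝ᵥ x = 0 at h1
    rw [sub_dotProduct, sub_eq_zero, sum_dotProduct] at h1
    rw [h1, dotProduct, ← Finset.sum_neg_distrib]
    refine Finset.sum_congr rfl fun j _ => ?_
    rw [smul_dotProduct, hα, smul_eq_mul, mul_neg, neg_neg]
  have hker : ∀ x ∈ dualCode R, α x = 0 → x ∈ dualCode E := by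
    intro x hx h0 b hb
    change b ⬝ᵥ x = 0
    rw [key b hb x hx, h0, dotProduct_zero, neg_zero]
  -- On E the kernel of α is exactly R, so the image has dimension c. Hence α can be adjusted by
  -- elements of E, where Φ vanishes, and Φ and α take prescribed values simultaneously.
  have hαE : E.map α = ⊤ := by
    apply Submodule.eq_top_of_finrank_eq
    have h := finrank_map_add_finrank_ker_inf α E
    have h2 : LinearMap.ker α ⊓ E = R := by
      ext x
      constructor
      · rintro ⟨h1, h2⟩
        exact ⟨h2, hker x (hEP h2) h1⟩
      · rintro ⟨h1, h2⟩
        refine ⟨?_, h1⟩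
        change α x = 0
        funext j
        have := h2 _ (hwE j)
        change w j ⬝ᵥ x = 0 at this
        rw [hα, this, neg_zero]; rfl
    rw [h2] at h
    rw [Module.finrank_fin_fun]
    omega
  have hαs : ∀ w s, ∃ x ∈ dualCode R, Φ x = w ∧ α x = s := by
    intro w s
    obtain ⟨x, hx, hxw⟩ := hΦs w
    have : s - α x ∈ E.map α := hαE ▸ Submodule.mem_top
    obtain ⟨a, ha, hax⟩ := this
    refine ⟨x + a, Submodule.add_mem _ hx (hEP ha), ?_, ?_⟩
    · rw [map_add, (hΦ a (hEP ha)).2 ha, hxw, add_zero]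
    · rw [map_add, hax]; abel
  refine ⟨dualCode R, Φ, α, β, hEP, hΦ, hαs, hker, ?_⟩
  intro x s
  constructor
  · intro h
    have hx : x ∈ dualCode R := by
      intro r hr
      have := h r hr.1
      rwa [(hβ r hr.1).2 hr, zero_dotProduct, add_zero] at this
    refine ⟨hx, ?_⟩
    have h0 : ∀ v, (s - α x) ⬝ᵥ v = 0 := by
      intro v
      obtain ⟨b, hb, rfl⟩ := hβs v
      have := h b hb
      rw [key b hb x hx] at this
      rw [dotProduct_comm, dotProduct_sub]
      linear_combination this
    exact (sub_eq_zero.1 (dotProduct_eq_zero_iff.1 h0)).symm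
  · rintro ⟨hx, rfl⟩ b hb
    rw [key b hb x hx, neg_add_cancel]

/-- The weight hypothesis of the stabilizer construction, on supports. -/
theorem eq_zero_of_support_subset {F ι : Type*} [Field F] [DecidableEq F] [Fintype ι]
    {C : Submodule F (ι → F)} {d : ℕ}
    (hd : ∀ y ∈ C, y ≠ 0 → d ≤ hammingNorm y) {S : Finset ι} (hS : S.card < d) :
    ∀ y ∈ C, (∀ i ∉ S, y i = 0) → y = 0 := by
  intro y hy h
  by_contra h0
  refine absurd (hd y hy h0) (not_le.2 (lt_of_le_of_lt (Finset.card_le_card fun i hi => ?_) hS))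
  by_contra hiS
  exact (Finset.mem_filter.1 hi).2 (h i hiS)

/-! ### Stabilizer codes: averaging, encoder, error detection. -/

section Quantum

variable {F ι : Type*} [Field F] [Fintype F]

/-- The character `χ` of the Weyl operators takes the value `1` on a whole subspace of scalars only
if that subspace is zero. -/
theorem eq_zero_of_forall_primitiveChar_eq_one {x : F}
    (h : ∀ r : F, AddChar.FiniteField.primitiveChar_to_Complex F (r * x) = 1) : x = 0 := by
  by_contra hx
  refine AddChar.FiniteField.primitiveChar_to_Complex_isPrimitive F hx ?_
  ext r
  rw [AddChar.mulShift_apply, mul_comm, h, AddChar.one_apply]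

section Average

variable [Fintype ι] [DecidableEq ι]

/-- A function that only depends on coordinates in `S`, averaged over a code `E` whose dual has no
nonzero word supported on `S`, is constant. -/
theorem sum_add_eq_average (E : Submodule F (ι → F)) (S : Finset ι)
    (hS : ∀ y ∈ dualCode E, (∀ i ∉ S, y i = 0) → y = 0) (g : (ι → F) → ℂ)
    (hg : ∀ x y : ι → F, (∀ i ∈ S, x i = y i) → g x = g y) [Fintype E] (x : ι → F) :
    ∑ e : E, g (x + e) =
      Fintype.card E * ((∑ y, g y) / (Fintype.card (ι → F) : ℂ)) := by
  classical
  -- Words vanishing on S, which `g` cannot see. A word orthogonal to both E and Z is a dual word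
  -- supported on S, so E + Z is the whole space and any translation can be absorbed into the sum
  -- over E.
  let Z : Submodule F (ι → F) :=
    { carrier := {v | ∀ i ∈ S, v i = 0}
      add_mem' := fun {a b} ha hb i hi => by rw [Pi.add_apply, ha i hi, hb i hi, add_zero]
      zero_mem' := fun i _ => rfl
      smul_mem' := fun r a ha i hi => by rw [Pi.smul_apply, ha i hi, smul_zero] }
  have htop : E ⊔ Z = ⊤ := by
    have h0 : dualCode (E ⊔ Z) = ⊥ := by
      rw [eq_bot_iff]
      intro y hy
      refine (Submodule.mem_bot F).2 (hS y (dualCode_anti le_sup_left hy) fun i hi => ?_)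
      have := dualCode_anti le_sup_right hy (Pi.single i 1) (fun j hj => by
        rw [Pi.single_eq_of_ne]
        rintro rfl
        exact hi hj)
      simpa [dotProductBilin] using this
    rw [← dualCode_dualCode (E ⊔ Z), h0, eq_top_iff]
    rintro x - y hy
    rw [(Submodule.mem_bot F).1 hy]
    simp
  have hinv : ∀ v, ∑ e : E, g (v + x + e) = ∑ e : E, g (x + e) := by
    intro v
    obtain ⟨a, ha, z, hz, rfl⟩ := Submodule.mem_sup.1 (htop ▸ Submodule.mem_top : v ∈ E ⊔ Z)
    refine Fintype.sum_equiv (Equiv.addRight (⟨a, ha⟩ : E)) _ _ fun e => hg _ _ fun i hi => ?_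
    have := hz i hi
    simp only [Pi.add_apply, this, Equiv.coe_addRight, Submodule.coe_add]
    ring
  have hsum : ∑ v : ι → F, ∑ e : E, g (v + x + e) = Fintype.card E * ∑ y, g y := by
    rw [Finset.sum_comm, ← nsmul_eq_mul, ← Finset.card_univ, ← Finset.sum_const]
    refine Finset.sum_congr rfl fun e _ => ?_
    exact Fintype.sum_equiv (Equiv.addRight (x + e)) _ _ fun v => by
      rw [Equiv.coe_addRight, add_assoc]
  rw [Finset.sum_congr rfl fun v _ => hinv v, Finset.sum_const, Finset.card_univ,
    nsmul_eq_mul] at hsum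
  have hne : (Fintype.card (ι → F) : ℂ) ≠ 0 := Nat.cast_ne_zero.2 Fintype.card_ne_zero
  rw [← mul_div_assoc, ← hsum]
  field_simp

/-- A function invariant under translations by `E`, weighted by `g`, only sees averages of `g`. -/
theorem sum_mul_eq_of_invariant (E : Submodule F (ι → F)) (S : Finset ι)
    (hS : ∀ y ∈ dualCode E, (∀ i ∉ S, y i = 0) → y = 0) (g h : (ι → F) → ℂ)
    (hg : ∀ x y : ι → F, (∀ i ∈ S, x i = y i) → g x = g y)
    (hh : ∀ x, ∀ e ∈ E, h (x + e) = h x) :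
    ∑ x, g x * h x = (∑ y, g y) / (Fintype.card (ι → F) : ℂ) * ∑ x, h x := by
  classical
  have : Fintype E := Fintype.ofFinite E
  have h1 : ∀ e : E, ∑ x, g (x + e) * h x = ∑ x, g x * h x := fun e =>
    Fintype.sum_equiv (Equiv.addRight (e : ι → F)) _ _ fun x => by
      rw [Equiv.coe_addRight, hh x e e.2]
  have h2 : ∑ e : E, ∑ x, g (x + e) * h x = Fintype.card E * ∑ x, g x * h x := by
    rw [Finset.sum_congr rfl fun e _ => h1 e, Finset.sum_const, Finset.card_univ, nsmul_eq_mul]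
  rw [Finset.sum_comm] at h2
  simp_rw [← Finset.sum_mul, sum_add_eq_average E S hS g hg] at h2
  rw [← Finset.mul_sum, mul_assoc] at h2
  exact (mul_left_cancel₀ (Nat.cast_ne_zero.2 Fintype.card_ne_zero) h2).symm

end Average

variable [DecidableEq F]

theorem weyl_kronecker_mulVec_apply {κ κ' : Type*} [Fintype κ] [DecidableEq κ] [Fintype κ']
    [DecidableEq κ'] (a b : κ → F)
    (a' b' : κ' → F) (u : (κ → F) × (κ' → F) → ℂ) (x : κ → F) (s : κ' → F) :
    ((weyl a b ⊗ₖ weyl a' b') *ᵥ u) (x, s) =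
      AddChar.FiniteField.primitiveChar_to_Complex F (b ⬝ᵥ (x - a) + b' ⬝ᵥ (s - a')) *
        u (x - a, s - a') := by
  rw [Matrix.mulVec, dotProduct, Finset.sum_eq_single (x - a, s - a')]
  · simp [weyl, AddChar.map_add_eq_mul]
  · rintro ⟨y, r⟩ _ hy
    by_cases h1 : x = y + a
    · have : s ≠ r + a' := by
        rintro rfl
        exact hy (by rw [h1, add_sub_cancel_right, add_sub_cancel_right])
      simp [weyl, this]
    · simp [weyl, h1]
  · simp

variable [Fintype ι] [DecidableEq ι]

/-- Detection of errors on the qudits in `S` by states that are supported on the graph of `α` over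
`P` and invariant under the translations by `(e, α e)`, `e ∈ E`. -/
theorem star_dotProduct_mulVec_eq {c : ℕ} {E P : Submodule F (ι → F)}
    {α : (ι → F) →ₗ[F] (Fin c → F)} (hP : ∀ x ∈ P, α x = 0 → x ∈ dualCode E) {S : Finset ι}
    (hS : ∀ y ∈ dualCode E, (∀ i ∉ S, y i = 0) → y = 0) {O : Matrix (ι → F) (ι → F) ℂ}
    (hO : IsSupportedOn S O) {u v : (ι → F) × (Fin c → F) → ℂ}
    (hu : ∀ x s, u (x, s) ≠ 0 → x ∈ P ∧ α x = s) (hv : ∀ x s, v (x, s) ≠ 0 → x ∈ P ∧ α x = s)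
    (hu' : ∀ x s, ∀ e ∈ E, u (x + e, s + α e) = u (x, s))
    (hv' : ∀ x s, ∀ e ∈ E, v (x + e, s + α e) = v (x, s)) :
    star u ⬝ᵥ ((O ⊗ₖ (1 : Matrix (Fin c → F) (Fin c → F) ℂ)) *ᵥ v)
      = O.trace / (Fintype.card (ι → F) : ℂ) * (star u ⬝ᵥ v) := by
  obtain ⟨A, hA⟩ := hO
  -- Only the diagonal of O survives: graph points over the same s that agree off S differ by a dual
  -- word supported on S.
  have hdiag : ∀ x s, star (u (x, s)) *
      ((O ⊗ₖ (1 : Matrix (Fin c → F) (Fin c → F) ℂ)) *ᵥ v) (x, s)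
        = O x x * (star (u (x, s)) * v (x, s)) := by
    intro x s
    by_cases hux : u (x, s) = 0
    · simp [hux]
    rw [Matrix.mulVec, dotProduct, Finset.sum_eq_single (x, s)]
    · simp only [Matrix.kroneckerMap_apply, Matrix.one_apply_eq]
      ring
    · rintro ⟨y, r⟩ _ hne
      by_cases hr : s = r
      · subst hr
        by_cases hvy : v (y, s) = 0
        · rw [hvy, mul_zero]
        have hxy : ¬ ∀ i, i ∉ S → x i = y i := by
          intro h
          obtain ⟨hx, hxs⟩ := hu x s hux
          obtain ⟨hy, hys⟩ := hv y s hvy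
          have h0 := hS (x - y) (hP _ (P.sub_mem hx hy) (by rw [map_sub, hxs, hys, sub_self]))
            fun i hi => by rw [Pi.sub_apply, h i hi, sub_self]
          exact hne (by rw [sub_eq_zero.1 h0])
        simp [hA, hxy]
      · simp [Matrix.one_apply_ne hr]
    · simp
  have hsum := sum_mul_eq_of_invariant E S hS (fun x => O x x)
    (fun x => ∑ s, star (u (x, s)) * v (x, s))
    (fun x y hxy => by
      have : (fun i : S => x i) = fun i : S => y i := funext fun i => hxy i i.2
      simp [hA, this])
    (fun x e he => by
      exact (Fintype.sum_equiv (Equiv.addRight (α e)) _ _ fun s => by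
        rw [Equiv.coe_addRight, hu' x s e he, hv' x s e he]).symm)
  simp only [dotProduct, Pi.star_apply, Fintype.sum_prod_type, hdiag]
  simp only [← Finset.mul_sum]
  exact hsum

/-- A surjective additive coordinate map on `P` gives rise to an isometric encoder. -/
theorem exists_encoder {k c : ℕ} (P : Submodule F (ι → F)) (Φ : (ι → F) →ₗ[F] (Fin k → F))
    (α : (ι → F) →ₗ[F] (Fin c → F)) (hs : ∀ w s, ∃ x ∈ P, Φ x = w ∧ α x = s) :
    ∃ (Q : EACode F ι k c) (κ : ℂ), κ ≠ 0 ∧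
      (∀ x w s, x ∈ P ∧ Φ x = w ∧ α x = s → Q.encoder x (w, s) = κ) ∧
      (∀ x w s, ¬ (x ∈ P ∧ Φ x = w ∧ α x = s) → Q.encoder x (w, s) = 0) := by
  classical
  let fib : (Fin k → F) × (Fin c → F) → Finset (ι → F) := fun p =>
    Finset.univ.filter fun x => x ∈ P ∧ Φ x = p.1 ∧ α x = p.2
  have hfib : ∀ p x, x ∈ fib p ↔ x ∈ P ∧ Φ x = p.1 ∧ α x = p.2 := fun p x => by simp [fib]
  -- The fibres are translates of one another, so a single constant normalises all columns of the
  -- encoder.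
  have hcard : ∀ p, (fib p).card = (fib 0).card := by
    intro p
    obtain ⟨x₀, hx₀, h1, h2⟩ := hs p.1 p.2
    symm
    refine Finset.card_bij (fun x _ => x + x₀) ?_ ?_ ?_
    · intro x hx
      obtain ⟨a, b, c⟩ := (hfib _ _).1 hx
      refine (hfib _ _).2 ⟨P.add_mem a hx₀, ?_, ?_⟩
      · rw [map_add, b, h1]; exact zero_add _
      · rw [map_add, c, h2]; exact zero_add _
    · intro x _ y _ h
      exact add_right_cancel h
    · intro y hy
      obtain ⟨a, b, c⟩ := (hfib _ _).1 hy
      refine ⟨y - x₀, (hfib _ _).2 ⟨P.sub_mem a hx₀, ?_, ?_⟩, sub_add_cancel _ _⟩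
      · rw [map_sub, b, h1, sub_self]; rfl
      · rw [map_sub, c, h2, sub_self]; rfl
  have hpos : 0 < ((fib 0).card : ℝ) := by
    refine Nat.cast_pos.2 (Finset.card_pos.2 ⟨0, (hfib _ _).2 ⟨P.zero_mem, map_zero _, map_zero _⟩⟩)
  let κ : ℂ := ((Real.sqrt (fib 0).card)⁻¹ : ℝ)
  have hκ : star κ * κ * (fib 0).card = 1 := by
    have h : (Real.sqrt (fib 0).card)⁻¹ * (Real.sqrt (fib 0).card)⁻¹ * ((fib 0).card : ℝ) = 1 := by
      rw [← mul_inv, Real.mul_self_sqrt hpos.le, inv_mul_cancel₀ hpos.ne']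
    rw [show star κ = κ from Complex.conj_ofReal _]
    rw [← Complex.ofReal_natCast, ← Complex.ofReal_mul, ← Complex.ofReal_mul, h, Complex.ofReal_one]
  let enc : Matrix (ι → F) ((Fin k → F) × (Fin c → F)) ℂ :=
    Matrix.of fun x p => if x ∈ fib p then κ else 0
  have henc : encᴴ * enc = 1 := by
    ext p p'
    rw [Matrix.mul_apply]
    by_cases hp : p = p'
    · subst hp
      rw [Matrix.one_apply_eq, ← hκ, ← hcard p]
      have : ∀ x, encᴴ p x * enc x p = if x ∈ fib p then star κ * κ else 0 := by
        intro x
        rw [Matrix.conjTranspose_apply]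
        by_cases hx : x ∈ fib p <;> simp [enc, hx]
      rw [Finset.sum_congr rfl fun x _ => this x, Finset.sum_ite_mem, Finset.univ_inter,
        Finset.sum_const, nsmul_eq_mul, mul_comm]
    · rw [Matrix.one_apply_ne hp]
      refine Finset.sum_eq_zero fun x _ => ?_
      rw [Matrix.conjTranspose_apply]
      by_cases hx : x ∈ fib p
      · have hx' : x ∉ fib p' := by
          intro hx'
          rw [hfib] at hx hx'
          exact hp (Prod.ext (hx.2.1.symm.trans hx'.2.1) (hx.2.2.symm.trans hx'.2.2))
        simp [enc, hx']
      · simp [enc, hx]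
  refine ⟨⟨enc, henc⟩, κ, ?_, ?_, ?_⟩
  · rintro h
    rw [h, mul_zero, zero_mul] at hκ
    exact zero_ne_one hκ
  · intro x w s h
    exact if_pos ((hfib (w, s) x).2 h)
  · intro x w s h
    exact if_neg fun h' => h ((hfib (w, s) x).1 h')

/-- The encoded states of an encoder as in `exists_encoder`, where `Φ` vanishes on `E ≤ P` only. -/
theorem mem_codeSpace_iff {k c : ℕ} {E P : Submodule F (ι → F)} {Φ : (ι → F) →ₗ[F] (Fin k → F)}
    {α : (ι → F) →ₗ[F] (Fin c → F)} (hEP : E ≤ P) (hΦ : ∀ x ∈ P, Φ x = 0 ↔ x ∈ E)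
    (hs : ∀ w s, ∃ x ∈ P, Φ x = w ∧ α x = s) (Q : EACode F ι k c) {κ : ℂ} (hκ : κ ≠ 0)
    (h1 : ∀ x w s, x ∈ P ∧ Φ x = w ∧ α x = s → Q.encoder x (w, s) = κ)
    (h2 : ∀ x w s, ¬ (x ∈ P ∧ Φ x = w ∧ α x = s) → Q.encoder x (w, s) = 0)
    (u : (ι → F) × (Fin c → F) → ℂ) :
    u ∈ Q.codeSpace ↔ (∀ x s, u (x, s) ≠ 0 → x ∈ P ∧ α x = s) ∧
      ∀ x s, ∀ e ∈ E, u (x + e, s + α e) = u (x, s) := by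
  set ν : ℂ := ((Real.sqrt ((Fintype.card F : ℝ) ^ c) : ℝ) : ℂ)⁻¹ with hν
  have hν0 : ν ≠ 0 := by
    rw [hν]
    refine inv_ne_zero (Complex.ofReal_ne_zero.2 (Real.sqrt_ne_zero'.2 (pow_pos ?_ _)))
    exact Nat.cast_pos.2 Fintype.card_pos
  have henc : ∀ ψ x s, x ∈ P → α x = s → Q.encode ψ (x, s) = ν * (κ * ψ (Φ x)) := by
    intro ψ x s hx hxs
    change ν * _ = _
    rw [Finset.sum_eq_single (Φ x)]
    · rw [h1 x _ s ⟨hx, rfl, hxs⟩]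
    · intro w _ hw
      rw [h2 x w s fun h => hw h.2.1.symm, zero_mul]
    · simp
  have henc0 : ∀ ψ x s, ¬ (x ∈ P ∧ α x = s) → Q.encode ψ (x, s) = 0 := by
    intro ψ x s hx
    change ν * _ = _
    rw [Finset.sum_eq_zero, mul_zero]
    intro w _
    rw [h2 x w s fun h => hx ⟨h.1, h.2.2⟩, zero_mul]
  constructor
  · rintro ⟨ψ, rfl⟩
    refine ⟨fun x s h => ?_, fun x s e he => ?_⟩
    · by_contra h'
      exact h (henc0 ψ x s h')
    · by_cases hx : x ∈ P ∧ α x = s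
      · rw [henc ψ x s hx.1 hx.2, henc ψ _ _ (P.add_mem hx.1 (hEP he)) (by rw [map_add, hx.2]),
          map_add, (hΦ e (hEP he)).2 he, add_zero]
      · rw [henc0 ψ x s hx, henc0]
        rintro ⟨h, h'⟩
        rw [map_add] at h'
        exact hx ⟨by simpa using P.sub_mem h (hEP he), add_right_cancel h'⟩
  · rintro ⟨hu, hu'⟩
    -- One base point per message, with receiver label 0. Any other graph point with the same
    -- message is reached by a translation by (e, α e), so the value there determines u.
    choose σ hσP hσ using fun w => hs w 0
    refine ⟨fun w => ν⁻¹ * κ⁻¹ * u (σ w, 0), ?_⟩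
    funext ⟨x, s⟩
    by_cases hx : x ∈ P ∧ α x = s
    · obtain ⟨hxP, rfl⟩ := hx
      rw [henc _ x _ hxP rfl]
      have he : x - σ (Φ x) ∈ E := by
        refine (hΦ _ (P.sub_mem hxP (hσP _))).1 ?_
        rw [map_sub, (hσ _).1, sub_self]
      have := hu' (σ (Φ x)) 0 _ he
      rw [add_sub_cancel, map_sub, (hσ _).2, sub_zero, zero_add] at this
      rw [this]
      field_simp
    · rw [henc0 _ x s hx]
      by_contra h
      exact hx (hu x s fun h' => h h'.symm)

/-- The entanglement-assisted stabilizer code of a linear code `E`. -/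
theorem exists_stabilizerCode (E : Submodule F (ι → F)) {k c d : ℕ}
    (hc : Module.finrank F (E ⊓ dualCode E : Submodule F (ι → F)) + c = Module.finrank F E)
    (hk : k + 2 * Module.finrank F E = Fintype.card ι + c)
    (hd : ∀ y ∈ dualCode E, y ≠ 0 → d ≤ hammingNorm y) :
    ∃ Q : EACode F ι k c, Q.IsStabilizerCodeOf E ∧ Q.MinDistGE d := by
  obtain ⟨P, Φ, α, β, hEP, hΦ, hs, hker, hstab⟩ := exists_symplectic_coordinates E hc hk
  obtain ⟨Q, κ, hκ, h1, h2⟩ := exists_encoder P Φ α hs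
  have hmem := mem_codeSpace_iff hEP hΦ hs Q hκ h1 h2
  refine ⟨Q, ⟨fun a _ => α a, fun _ b => β b, fun _ _ => 1, fun u => ?_⟩, ?_⟩
  · rw [hmem]
    constructor
    · rintro ⟨hu, hu'⟩ a ha b hb
      rw [one_smul]
      funext ⟨x, s⟩
      rw [weyl_kronecker_mulVec_apply]
      have h := hu' (x - a) (s - α a) a ha
      rw [sub_add_cancel, sub_add_cancel] at h
      rw [h]
      by_cases h0 : u (x - a, s - α a) = 0
      · rw [h0, mul_zero]
      · rw [(hstab _ _).2 (hu _ _ h0) b hb, AddChar.map_zero_eq_one, one_mul]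
    · intro h
      have h' : ∀ a ∈ E, ∀ b ∈ E, ∀ x s,
          AddChar.FiniteField.primitiveChar_to_Complex F (b ⬝ᵥ (x - a) + β b ⬝ᵥ (s - α a)) *
            u (x - a, s - α a) = u (x, s) := by
        intro a ha b hb x s
        have := congrFun (h a ha b hb) (x, s)
        rwa [one_smul, weyl_kronecker_mulVec_apply] at this
      refine ⟨fun x s hu => (hstab x s).1 fun b hb => ?_, fun x s e he => ?_⟩
      -- Linearity of E and β over F is used here: replacing b by r • b for all r upgrades a trivial
      -- character value to a vanishing scalar.
      · refine eq_zero_of_forall_primitiveChar_eq_one fun r => ?_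
        have := h' 0 E.zero_mem (r • b) (E.smul_mem r hb) x s
        rw [map_zero, sub_zero, sub_zero, map_smul, smul_dotProduct, smul_dotProduct,
          smul_eq_mul, smul_eq_mul, ← mul_add] at this
        exact mul_right_cancel₀ hu (this.trans (one_mul _).symm)
      · have := h' e he 0 E.zero_mem (x + e) (s + α e)
        rw [map_zero, zero_dotProduct, zero_dotProduct, add_zero, AddChar.map_zero_eq_one, one_mul,
          add_sub_cancel_right, add_sub_cancel_right] at this
        exact this.symm
  · intro S hS O hO
    have hS' := eq_zero_of_support_subset hd hS
    have key : ∀ u ∈ Q.codeSpace, ∀ v ∈ Q.codeSpace,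
        star u ⬝ᵥ ((O ⊗ₖ (1 : Matrix (Fin c → F) (Fin c → F) ℂ)) *ᵥ v)
          = O.trace / (Fintype.card (ι → F) : ℂ) * (star u ⬝ᵥ v) := by
      intro u hu v hv
      rw [hmem] at hu hv
      exact star_dotProduct_mulVec_eq hker hS' hO hu.1 hv.1 hu.2 hv.2
    exact ⟨⟨_, key⟩, fun _ u hu => key u hu u hu⟩

end Quantum

/-! ### Monomial evaluations on a finite field. -/

section ReedSolomon

variable {K : Type*} [Field K]

theorem mem_rsCode {Δ : Finset ℕ} {v : K → K} :
    v ∈ rsCode K Δ ↔ ∃ c : ℕ → K, ∀ P, v P = ∑ i ∈ Δ, c i * P ^ i := by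
  classical
  rw [rsCode, Submodule.mem_span_image_finset_iff_exists_fun]
  constructor
  · rintro ⟨c, rfl⟩
    refine ⟨fun i => if h : i ∈ Δ then c ⟨i, h⟩ else 0, fun P => ?_⟩
    rw [← Finset.sum_attach Δ, Finset.sum_apply]
    exact Finset.sum_congr rfl fun i _ => by simp
  · rintro ⟨c, hc⟩
    refine ⟨fun i => c i, ?_⟩
    funext P
    rw [hc, ← Finset.sum_attach Δ, Finset.sum_apply]
    exact Finset.sum_congr rfl fun i _ => by simp

theorem pow_mem_rsCode {Δ : Finset ℕ} {i : ℕ} (hi : i ∈ Δ) :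
    (fun P : K => P ^ i) ∈ rsCode K Δ :=
  Submodule.subset_span ⟨i, hi, by simp⟩

variable [Fintype K]

/-- Monomials of degree less than `#K` are independent as functions on `K`. -/
theorem coeff_eq_zero_of_sum_pow_eq_zero {Δ : Finset ℕ} (hΔ : ∀ i ∈ Δ, i < Fintype.card K)
    {c : ℕ → K} (h : ∀ P : K, ∑ i ∈ Δ, c i * P ^ i = 0) : ∀ i ∈ Δ, c i = 0 := by
  have hp : ∑ i ∈ Δ, Polynomial.monomial i (c i) = 0 := by
    refine Polynomial.eq_zero_of_natDegree_lt_card_of_eval_eq_zero' _ Finset.univ (fun P _ => ?_) ?_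
    · simpa [Polynomial.eval_finsetSum] using h P
    · rw [Finset.card_univ]
      refine lt_of_le_of_lt (Polynomial.natDegree_sum_le_of_forall_le (n := Fintype.card K - 1) Δ _
        fun i hi => ?_) (Nat.sub_lt Fintype.card_pos one_pos)
      exact (Polynomial.natDegree_monomial_le _).trans (Nat.le_sub_one_of_lt (hΔ i hi))
  intro i hi
  have := congrArg (fun p => p.coeff i) hp
  simpa [Polynomial.finsetSum_coeff, Polynomial.coeff_monomial, hi] using this

theorem finrank_rsCode {Δ : Finset ℕ} (hΔ : ∀ i ∈ Δ, i < Fintype.card K) :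
    Module.finrank K (rsCode K Δ) = Δ.card := by
  have hli : LinearIndependent K (fun (i : Δ) (P : K) => P ^ (i : ℕ)) := by
    change LinearIndepOn K (fun (i : ℕ) (P : K) => P ^ i) (Δ : Set ℕ)
    rw [linearIndepOn_finset_iff]
    intro f hf
    refine coeff_eq_zero_of_sum_pow_eq_zero hΔ fun P => ?_
    simpa using congrFun hf P
  have h := finrank_span_eq_card hli
  rw [Fintype.card_coe] at h
  have hspan : rsCode K Δ = Submodule.span K (Set.range fun (i : Δ) (P : K) => P ^ (i : ℕ)) := by
    rw [rsCode]
    congr 1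
    ext v
    simp
  rw [← h, hspan]

/-- The bilinear form on monomials. -/
theorem sum_pow_add (hK : 2 < Fintype.card K) {i j : ℕ} (hi : i < Fintype.card K - 1)
    (hj : j < Fintype.card K - 1) :
    ∑ P : K, P ^ (i + j) = if i + j = Fintype.card K - 1 then -1 else 0 := by
  classical
  rcases lt_trichotomy (i + j) (Fintype.card K - 1) with h | h | h
  · rw [if_neg h.ne, FiniteField.sum_pow_lt_card_sub_one K _ h]
  · rw [if_pos h, h, ← Finset.sum_erase_add _ _ (Finset.mem_univ (0 : K)),
      Finset.sum_congr rfl fun P hP =>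
        FiniteField.pow_card_sub_one_eq_one P (Finset.ne_of_mem_erase hP),
      Finset.sum_const, Finset.card_erase_of_mem (Finset.mem_univ _), Finset.card_univ,
      zero_pow (by omega), add_zero, nsmul_one, Nat.cast_sub (by omega),
      FiniteField.cast_card_eq_zero, Nat.cast_one, zero_sub]
  -- One reduction by #K - 1 brings the exponent below #K - 1. It stays positive, so the summand at
  -- P = 0 is unchanged.
  · rw [if_neg h.ne', ← FiniteField.sum_pow_lt_card_sub_one K (i + j - (Fintype.card K - 1))
      (by omega)]
    refine Finset.sum_congr rfl fun P _ => ?_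
    by_cases hP : P = 0
    · rw [hP, zero_pow (by omega), zero_pow (by omega)]
    · rw [← one_mul (P ^ (i + j - _)), ← FiniteField.pow_card_sub_one_eq_one P hP, ← pow_add]
      congr 1
      omega

end ReedSolomon

/-- X^#F - X has too few roots to vanish on K. In the quadratic case, 1 and such a θ form a basis of
K over F. -/
theorem exists_pow_card_ne {F K : Type*} [Field F] [Field K] [Fintype F] [Fintype K]
    (hFK : Fintype.card F < Fintype.card K) :
    ∃ θ : K, θ ^ Fintype.card F ≠ θ := by
  by_contra! h
  have h1 := Fintype.one_lt_card (α := F)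
  refine FiniteField.X_pow_card_sub_X_ne_zero K h1
    (Polynomial.eq_zero_of_natDegree_lt_card_of_eval_eq_zero' _ Finset.univ (fun P _ => ?_) ?_)
  · simp [h]
  · rwa [FiniteField.X_pow_card_sub_X_natDegree_eq K h1, Finset.card_univ]

/-! ### Subfield subcodes: descent, hull and BCH bound. -/

section BCH

variable {F K : Type*} [Field F] [Field K] [Algebra F K]

theorem mem_bchCode {Δ : Finset ℕ} {y : K → F} :
    y ∈ bchCode F K Δ ↔ (fun P => algebraMap F K (y P)) ∈ rsCode K Δ := Iff.rfl

variable [Fintype F]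

/-- A set of exponents such that the code that it defines is stable under Frobenius. -/
def IsFrobeniusStable (F K : Type*) [Field K] [Fintype F] (Δ : Finset ℕ) : Prop :=
  ∀ i ∈ Δ, ∃ j ∈ Δ, ∀ P : K, P ^ (i * Fintype.card F) = P ^ j

theorem add_pow_card_eq (x y : K) :
    (x + y) ^ Fintype.card F = x ^ Fintype.card F + y ^ Fintype.card F :=
  map_add (FiniteField.frobeniusAlgHom F K) x y

theorem sum_pow_card_eq {κ : Type*} (s : Finset κ) (f : κ → K) :
    (∑ i ∈ s, f i) ^ Fintype.card F = ∑ i ∈ s, f i ^ Fintype.card F :=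
  map_sum (FiniteField.frobeniusAlgHom F K) f s

theorem pow_card_mem_rsCode {Δ : Finset ℕ} (hΔ : IsFrobeniusStable F K Δ) {v : K → K}
    (hv : v ∈ rsCode K Δ) : (fun P => v P ^ Fintype.card F) ∈ rsCode K Δ := by
  obtain ⟨c, hc⟩ := mem_rsCode.1 hv
  have : (fun P => v P ^ Fintype.card F) =
      ∑ i ∈ Δ, c i ^ Fintype.card F • fun P : K => P ^ (i * Fintype.card F) := by
    funext P
    rw [hc, sum_pow_card_eq, Finset.sum_apply]
    refine Finset.sum_congr rfl fun i _ => ?_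
    rw [Pi.smul_apply, smul_eq_mul, mul_pow, ← pow_mul]
  rw [this]
  refine Submodule.sum_mem _ fun i hi => Submodule.smul_mem _ _ ?_
  obtain ⟨j, hj, hij⟩ := hΔ i hi
  simp_rw [hij]
  exact pow_mem_rsCode hj

theorem algebraMap_add_mul_injective {θ : K} (hθ : θ ^ Fintype.card F ≠ θ) {a b a' b' : F}
    (h : algebraMap F K a + θ * algebraMap F K b = algebraMap F K a' + θ * algebraMap F K b') :
    a = a' ∧ b = b' := by
  have hb : b = b' := by
    by_contra hb
    have hb' : algebraMap F K (b - b') ≠ 0 := by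
      rw [map_ne_zero_iff _ (algebraMap F K).injective]
      exact sub_ne_zero.2 hb
    have hθ' : θ = algebraMap F K ((a' - a) / (b - b')) := by
      rw [map_div₀, eq_div_iff hb', map_sub, map_sub]
      linear_combination h
    apply hθ
    rw [hθ', ← map_pow, FiniteField.pow_card]
  subst hb
  exact ⟨(algebraMap F K).injective (add_right_cancel h), rfl⟩

variable [Fintype K]

theorem card_eq_sq (hFK : Module.finrank F K = 2) : Fintype.card K = Fintype.card F ^ 2 := by
  rw [Module.card_eq_pow_finrank (K := F), hFK]

theorem card_lt_card (hFK : Module.finrank F K = 2) : Fintype.card F < Fintype.card K := by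
  rw [card_eq_sq hFK]
  nlinarith [Fintype.one_lt_card (α := F)]

/-- Descent: the Reed-Solomon code of a Frobenius stable set is spanned by its subfield subcode. -/
theorem exists_mem_bchCode_add (hFK : Module.finrank F K = 2) {Δ : Finset ℕ}
    (hΔ : IsFrobeniusStable F K Δ) {θ : K} (hθ : θ ^ Fintype.card F ≠ θ) {v : K → K}
    (hv : v ∈ rsCode K Δ) : ∃ a ∈ bchCode F K Δ, ∃ b ∈ bchCode F K Δ,
      ∀ P, v P = algebraMap F K (a P) + θ * algebraMap F K (b P) := by
  have hbij : Function.Bijective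
      fun p : F × F => algebraMap F K p.1 + θ * algebraMap F K p.2 := by
    rw [Fintype.bijective_iff_injective_and_card]
    refine ⟨fun p p' h => ?_, ?_⟩
    · obtain ⟨h1, h2⟩ := algebraMap_add_mul_injective hθ h
      exact Prod.ext h1 h2
    · rw [Fintype.card_prod, card_eq_sq hFK, sq]
  choose p hp using fun P => hbij.2 (v P)
  dsimp only at hp
  -- With v = a + θb, Frobenius fixes a and b, so v^#F - v = (θ^#F - θ)b, which isolates b inside
  -- the code.
  have hb : (fun P => algebraMap F K (p P).2) ∈ rsCode K Δ := by
    have h1 := Submodule.smul_mem _ (θ ^ Fintype.card F - θ)⁻¹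
      (Submodule.sub_mem _ (pow_card_mem_rsCode hΔ hv) hv)
    convert h1 using 1
    funext P
    have h2 : v P ^ Fintype.card F =
        algebraMap F K (p P).1 + θ ^ Fintype.card F * algebraMap F K (p P).2 := by
      rw [← hp P, add_pow_card_eq, mul_pow, ← map_pow, ← map_pow, FiniteField.pow_card,
        FiniteField.pow_card]
    rw [Pi.smul_apply, Pi.sub_apply, h2, smul_eq_mul, eq_inv_mul_iff_mul_eq₀ (sub_ne_zero.2 hθ),
      ← hp P]
    ring
  refine ⟨fun P => (p P).1, ?_, fun P => (p P).2, hb, fun P => (hp P).symm⟩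
  rw [mem_bchCode]
  convert Submodule.sub_mem _ hv (Submodule.smul_mem _ θ hb) using 1
  funext P
  rw [Pi.sub_apply, Pi.smul_apply, ← hp P, smul_eq_mul, add_sub_cancel_right]

/-- The map (a, b) ↦ a + θb identifies two copies of the BCH code with the Reed-Solomon code over F,
whose F-dimension is 2 #Δ. -/
theorem finrank_bchCode (hFK : Module.finrank F K = 2) {Δ : Finset ℕ}
    (hlt : ∀ i ∈ Δ, i < Fintype.card K) (hΔ : IsFrobeniusStable F K Δ) :
    Module.finrank F (bchCode F K Δ) = Δ.card := by
  obtain ⟨θ, hθ⟩ := exists_pow_card_ne (card_lt_card hFK)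
  let J : (bchCode F K Δ) →ₗ[F] (K → K) :=
    (Algebra.linearMap F K).compLeft K ∘ₗ (bchCode F K Δ).subtype
  let f : (bchCode F K Δ × bchCode F K Δ) →ₗ[F] (K → K) := J.coprod (θ • J)
  have hf : ∀ p P, f p P = algebraMap F K (p.1.1 P) + θ * algebraMap F K (p.2.1 P) :=
    fun p P => rfl
  have hinj : Function.Injective f := by
    intro p p' h
    have := fun P => algebraMap_add_mul_injective hθ (congrFun h P)
    exact Prod.ext (Subtype.ext (funext fun P => (this P).1))
      (Subtype.ext (funext fun P => (this P).2))
  have hrange : LinearMap.range f = (rsCode K Δ).restrictScalars F := by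
    ext v
    constructor
    · rintro ⟨p, rfl⟩
      exact Submodule.add_mem _ p.1.2 (Submodule.smul_mem (rsCode K Δ) θ p.2.2)
    · intro hv
      obtain ⟨a, ha, b, hb, h⟩ := exists_mem_bchCode_add hFK hΔ hθ hv
      exact ⟨(⟨a, ha⟩, ⟨b, hb⟩), funext fun P => (h P).symm⟩
  have h1 := LinearMap.finrank_range_of_inj hinj
  rw [hrange, Module.finrank_prod] at h1
  have h2 := Module.finrank_mul_finrank F K (rsCode K Δ)
  rw [hFK, finrank_rsCode hlt] at h2
  have h3 : Module.finrank F ((rsCode K Δ).restrictScalars F) = Module.finrank F (rsCode K Δ) := rfl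
  omega

/-- The parity checks of the dual of a BCH code. -/
theorem mem_dualCode_bchCode (hFK : Module.finrank F K = 2) {Δ : Finset ℕ}
    (hΔ : IsFrobeniusStable F K Δ) {y : K → F} :
    y ∈ dualCode (bchCode F K Δ) ↔
      ∀ i ∈ Δ, ∑ P : K, P ^ i * algebraMap F K (y P) = 0 := by
  constructor
  · intro hy i hi
    obtain ⟨θ, hθ⟩ := exists_pow_card_ne (card_lt_card hFK)
    obtain ⟨a, ha, b, hb, h⟩ := exists_mem_bchCode_add hFK hΔ hθ (pow_mem_rsCode hi)
    have ha' : algebraMap F K (a ⬝ᵥ y) = 0 := by rw [mem_dualCode.1 hy a ha, map_zero]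
    have hb' : algebraMap F K (b ⬝ᵥ y) = 0 := by rw [mem_dualCode.1 hy b hb, map_zero]
    simp only [dotProduct, map_sum, map_mul] at ha' hb'
    simp only [h, add_mul, mul_assoc, Finset.sum_add_distrib, ← Finset.mul_sum, ha', hb', mul_zero,
      add_zero]
  · intro h x hx
    change x ⬝ᵥ y = 0
    obtain ⟨c, hc⟩ := mem_rsCode.1 (mem_bchCode.1 hx)
    refine (algebraMap F K).injective ?_
    rw [dotProduct, map_sum, map_zero]
    simp only [map_mul, hc, Finset.sum_mul, mul_assoc]
    rw [Finset.sum_comm]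
    refine Finset.sum_eq_zero fun i hi => ?_
    rw [← Finset.mul_sum, h i hi, mul_zero]

/-- The hull of a BCH code is a BCH code. -/
theorem bchCode_inf_dualCode (hFK : Module.finrank F K = 2) {Δ : Finset ℕ}
    (hlt : ∀ i ∈ Δ, i < Fintype.card K - 1) (hΔ : IsFrobeniusStable F K Δ) :
    bchCode F K Δ ⊓ dualCode (bchCode F K Δ) =
      bchCode F K (Δ.filter fun i => ¬ (i ≠ 0 ∧ Fintype.card K - 1 - i ∈ Δ)) := by
  have hK : 2 < Fintype.card K := by
    rw [card_eq_sq hFK]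
    nlinarith [Fintype.one_lt_card (α := F)]
  have key : ∀ (c : ℕ → K) (y : K → F), (∀ P, algebraMap F K (y P) = ∑ i ∈ Δ, c i * P ^ i) →
      ∀ j ∈ Δ, ∑ P : K, P ^ j * algebraMap F K (y P) =
        ∑ i ∈ Δ, if i + j = Fintype.card K - 1 then - c i else 0 := by
    intro c y hy j hj
    simp only [hy, Finset.mul_sum]
    rw [Finset.sum_comm]
    refine Finset.sum_congr rfl fun i hi => ?_
    rw [← mul_neg_one (c i), ← mul_zero (c i), ← mul_ite, ← sum_pow_add hK (hlt i hi) (hlt j hj),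
      Finset.mul_sum]
    exact Finset.sum_congr rfl fun P _ => by ring
  ext y
  rw [Submodule.mem_inf, mem_dualCode_bchCode hFK hΔ, mem_bchCode, mem_bchCode, mem_rsCode,
    mem_rsCode]
  constructor
  · rintro ⟨⟨c, hc⟩, hy⟩
    refine ⟨c, fun P => ?_⟩
    rw [hc, Finset.sum_filter]
    refine Finset.sum_congr rfl fun i hi => ?_
    split_ifs with h
    -- The parity check with exponent #K - 1 - i sees only the coefficient of X^i, and so kills it.
    · have h1 := hy _ h.2
      rw [key c y hc _ h.2, Finset.sum_eq_single i, if_pos, neg_eq_zero] at h1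
      · rw [h1, zero_mul]
      · have := hlt i hi
        omega
      · intro i' hi' hne
        rw [if_neg]
        have := hlt i hi
        omega
      · exact fun h' => absurd hi h'
    · rfl
  · rintro ⟨c, hc⟩
    have hc' : ∀ P, algebraMap F K (y P) =
        ∑ i ∈ Δ, (if ¬ (i ≠ 0 ∧ Fintype.card K - 1 - i ∈ Δ) then c i else 0) * P ^ i := by
      intro P
      rw [hc, Finset.sum_filter]
      exact Finset.sum_congr rfl fun i _ => by rw [ite_mul, zero_mul]
    refine ⟨⟨_, hc'⟩, fun j hj => ?_⟩
    rw [key _ y hc' j hj]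
    refine Finset.sum_eq_zero fun i hi => ?_
    split_ifs with h1 h2
    · exact neg_zero
    · exfalso
      have h3 := hlt j hj
      refine h2 ⟨by omega, ?_⟩
      rwa [show Fintype.card K - 1 - i = j by omega]
    · rfl

/-- The BCH bound. -/
theorem lt_hammingNorm_of_mem_dualCode [DecidableEq F] (hFK : Module.finrank F K = 2)
    {Δ : Finset ℕ} (hΔ : IsFrobeniusStable F K Δ) {m : ℕ} (hm : ∀ i < m, i ∈ Δ) {y : K → F}
    (hy : y ∈ dualCode (bchCode F K Δ)) (hy0 : y ≠ 0) : m + 1 ≤ hammingNorm y := by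
  classical
  rw [mem_dualCode_bchCode hFK hΔ] at hy
  by_contra! hlt
  obtain ⟨P₀, hP₀⟩ := Function.ne_iff.1 hy0
  set S : Finset K := Finset.univ.filter fun P => y P ≠ 0 with hS
  have hS' : hammingNorm y = S.card := rfl
  have hP₀S : P₀ ∈ S := by simpa [hS] using hP₀
  -- This polynomial vanishes on the support of y except at P₀ and has degree #S - 1 < m, so it is a
  -- combination of parity checks that would force y P₀ = 0.
  let p : Polynomial K := ∏ P ∈ S.erase P₀, (Polynomial.X - Polynomial.C P)
  have hdeg : p.natDegree < m := by
    rw [Polynomial.natDegree_prod_of_monic _ _ fun P _ => Polynomial.monic_X_sub_C P]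
    simp only [Polynomial.natDegree_X_sub_C, Finset.sum_const, smul_eq_mul, mul_one]
    have := Finset.card_pos.2 ⟨P₀, hP₀S⟩
    rw [Finset.card_erase_of_mem hP₀S]
    omega
  have h0 : ∑ P : K, p.eval P * algebraMap F K (y P) = 0 := by
    simp only [Polynomial.eval_eq_sum_range' hdeg, Finset.sum_mul, mul_assoc]
    rw [Finset.sum_comm]
    refine Finset.sum_eq_zero fun i hi => ?_
    rw [← Finset.mul_sum, hy i (hm i (Finset.mem_range.1 hi)), mul_zero]
  rw [Finset.sum_eq_single P₀] at h0
  · rcases mul_eq_zero.1 h0 with h | h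
    · rw [Polynomial.eval_prod, Finset.prod_eq_zero_iff] at h
      obtain ⟨P, hP, h⟩ := h
      rw [Polynomial.eval_sub, Polynomial.eval_X, Polynomial.eval_C, sub_eq_zero] at h
      exact Finset.ne_of_mem_erase hP h.symm
    · exact hP₀ ((map_eq_zero_iff _ (algebraMap F K).injective).1 h)
  · intro P _ hne
    by_cases hP : y P = 0
    · rw [hP, map_zero, mul_zero]
    · have hPS : P ∈ S.erase P₀ := Finset.mem_erase.2 ⟨hne, by simpa [hS] using hP⟩
      rw [Polynomial.eval_prod, Finset.prod_eq_zero hPS, zero_mul]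
      simp
  · simp

end BCH

/-! ### Cyclotomic cosets modulo q² - 1 in base q. -/

section Cosets

variable {q : ℕ}

/-- The only excluded digit pair is (q - 1, q - 1), which is symmetric. -/
theorem digits_swap_lt {x y : ℕ} (hx : x < q) (hy : y < q) (h : x + y * q < q ^ 2 - 1) :
    y + x * q < q ^ 2 - 1 := by
  obtain ⟨p, rfl⟩ : ∃ p, q = p + 1 := ⟨q - 1, by omega⟩
  have hp : (p + 1) ^ 2 - 1 = p + p * (p + 1) := by
    have : (p + 1) ^ 2 = p + p * (p + 1) + 1 := by ring
    omega
  rw [hp] at h ⊢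
  by_contra! hc
  have hxp : x = p := by
    by_contra hne
    have : (x + 1) * (p + 1) ≤ p * (p + 1) := Nat.mul_le_mul_right _ (by omega)
    nlinarith
  subst hxp
  have hyp : y = x := by nlinarith
  subst hyp
  omega

/-- Since q² ≡ 1, multiplication by q swaps the two digits. It is therefore an involution, and
cosets have at most two elements. -/
theorem digits_mul_mod {x y : ℕ} (hx : x < q) (hy : y < q) (h : x + y * q < q ^ 2 - 1) :
    (x + y * q) * q % (q ^ 2 - 1) = y + x * q := by
  have hq : 1 ≤ q ^ 2 := Nat.one_le_pow _ _ (by omega)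
  have : (x + y * q) * q = y + x * q + (q ^ 2 - 1) * y := by
    zify [hq]
    ring
  rw [this, Nat.add_mul_mod_self_left, Nat.mod_eq_of_lt (digits_swap_lt hx hy h)]

theorem exists_digits {i : ℕ} (h : i < q ^ 2 - 1) :
    ∃ x < q, ∃ y < q, i = x + y * q := by
  have hq : 0 < q := by
    rcases Nat.eq_zero_or_pos q with rfl | h'
    · simp at h
    · exact h'
  refine ⟨i % q, Nat.mod_lt _ hq, i / q, ?_, by rw [mul_comm, Nat.mod_add_div]⟩
  rw [Nat.div_lt_iff_lt_mul hq, ← sq]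
  omega

theorem mul_mod_lt {i : ℕ} (h : i < q ^ 2 - 1) : i * q % (q ^ 2 - 1) < q ^ 2 - 1 :=
  Nat.mod_lt _ (by omega)

theorem mul_mod_mul_mod {i : ℕ} (h : i < q ^ 2 - 1) :
    i * q % (q ^ 2 - 1) * q % (q ^ 2 - 1) = i := by
  obtain ⟨x, hx, y, hy, rfl⟩ := exists_digits h
  rw [digits_mul_mod hx hy h, digits_mul_mod hy hx (digits_swap_lt hx hy h)]

theorem mem_coset {x y : ℕ} (h : x < q ^ 2 - 1) :
    y ∈ coset (q ^ 2 - 1) q x ↔ y = x ∨ y = x * q % (q ^ 2 - 1) := by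
  have key : ∀ s, x * q ^ s % (q ^ 2 - 1) = x ∨
      x * q ^ s % (q ^ 2 - 1) = x * q % (q ^ 2 - 1) := by
    intro s
    induction s with
    | zero => left; rw [pow_zero, mul_one, Nat.mod_eq_of_lt h]
    | succ s ih =>
      rw [pow_succ, ← mul_assoc, Nat.mul_mod, ← Nat.mod_mul_mod, Nat.mod_mod, Nat.mul_mod_mod]
      rcases ih with ih | ih <;> rw [ih]
      · right; rfl
      · left; exact mul_mod_mul_mod h
  classical
  rw [coset, Finset.mem_filter, Finset.mem_range]
  constructor
  · rintro ⟨-, s, rfl⟩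
    exact key s
  · rintro (rfl | rfl)
    · exact ⟨h, 0, by rw [pow_zero, mul_one, Nat.mod_eq_of_lt h]⟩
    · exact ⟨mul_mod_lt h, 1, by rw [pow_one]⟩

theorem mem_minReps {x : ℕ} :
    x ∈ minReps (q ^ 2 - 1) q ↔ x < q ^ 2 - 1 ∧ x ≤ x * q % (q ^ 2 - 1) := by
  rw [minReps, Finset.mem_filter, Finset.mem_range]
  refine and_congr_right fun h => ⟨fun H => H _ ((mem_coset h).2 (Or.inr rfl)), fun H y hy => ?_⟩
  rcases (mem_coset h).1 hy with rfl | rfl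
  · exact le_rfl
  · exact H

theorem min_mem_minReps {i : ℕ} (h : i < q ^ 2 - 1) :
    min i (i * q % (q ^ 2 - 1)) ∈ minReps (q ^ 2 - 1) q := by
  rw [mem_minReps]
  rcases le_total i (i * q % (q ^ 2 - 1)) with h' | h'
  · rw [min_eq_left h']
    exact ⟨h, h'⟩
  · rw [min_eq_right h', mul_mod_mul_mod h]
    exact ⟨mul_mod_lt h, h'⟩

theorem eq_min_of_mem_coset {m i : ℕ} (hm : m ∈ minReps (q ^ 2 - 1) q)
    (hi : i ∈ coset (q ^ 2 - 1) q m) : i < q ^ 2 - 1 ∧ m = min i (i * q % (q ^ 2 - 1)) := by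
  rw [mem_minReps] at hm
  rcases (mem_coset hm.1).1 hi with rfl | rfl
  · exact ⟨hm.1, (min_eq_left hm.2).symm⟩
  · rw [mul_mod_mul_mod hm.1]
    exact ⟨mul_mod_lt hm.1, (min_eq_right hm.2).symm⟩

theorem mem_coset_min {i : ℕ} (h : i < q ^ 2 - 1) :
    i ∈ coset (q ^ 2 - 1) q (min i (i * q % (q ^ 2 - 1))) := by
  rw [mem_coset (mem_minReps.1 (min_mem_minReps h)).1]
  rcases le_total i (i * q % (q ^ 2 - 1)) with h' | h'
  · exact Or.inl (min_eq_left h').symm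
  · rw [min_eq_right h', mul_mod_mul_mod h]
    exact Or.inr rfl

theorem finite_minReps (n : ℕ) : (Set.ofPred fun x => x ∈ minReps n q).Finite :=
  (minReps n q).finite_toSet

theorem card_finite_minReps (n : ℕ) :
    (finite_minReps (q := q) n).toFinset.card = (minReps n q).card := by
  congr 1
  ext x
  exact Set.Finite.mem_toFinset _

theorem rep_mem {n j : ℕ} (hj : j < (minReps n q).card) : rep n q j ∈ minReps n q :=
  Nat.nth_mem_of_lt_card (finite_minReps n) (by rwa [card_finite_minReps])

theorem rep_lt_rep {n i j : ℕ} (hij : i < j) (hj : j < (minReps n q).card) :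
    rep n q i < rep n q j :=
  Nat.nth_lt_nth_of_lt_card (finite_minReps n) hij (by rwa [card_finite_minReps])

theorem exists_rep_eq {n m : ℕ} (hm : m ∈ minReps n q) :
    ∃ j < (minReps n q).card, rep n q j = m := by
  obtain ⟨j, hj, h⟩ := Nat.exists_lt_card_finite_nth_eq (finite_minReps n) hm
  exact ⟨j, by rwa [card_finite_minReps] at hj, h⟩

/-- The least representatives are enumerated increasingly, so belonging to one of the first t + 1
cosets is an inequality for the least element of the coset. -/
theorem mem_Delta {t i : ℕ} (ht : t < (minReps (q ^ 2 - 1) q).card) :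
    i ∈ Delta (q ^ 2 - 1) q t ↔
      i < q ^ 2 - 1 ∧ min i (i * q % (q ^ 2 - 1)) ≤ rep (q ^ 2 - 1) q t := by
  rw [Delta, Finset.mem_biUnion]
  constructor
  · rintro ⟨j, hj, hi⟩
    rw [Finset.mem_range] at hj
    obtain ⟨h1, h2⟩ := eq_min_of_mem_coset (rep_mem (by omega)) hi
    refine ⟨h1, h2 ▸ ?_⟩
    rcases Nat.lt_or_ge j t with h | h
    · exact (rep_lt_rep h ht).le
    · exact (congrArg _ (by omega)).le
  · rintro ⟨h1, h2⟩
    obtain ⟨j, hj, h⟩ := exists_rep_eq (min_mem_minReps h1)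
    refine ⟨j, Finset.mem_range.2 ?_, h ▸ mem_coset_min h1⟩
    by_contra! hlt
    exact absurd (rep_lt_rep (i := t) (by omega) hj) (by omega)

/-- No least representative lies strictly between consecutive ones. This supplies the run of
consecutive exponents for the BCH bound. -/
theorem mem_Delta_of_lt {t i : ℕ} (ht : t + 1 < (minReps (q ^ 2 - 1) q).card)
    (hi : i < rep (q ^ 2 - 1) q (t + 1)) : i ∈ Delta (q ^ 2 - 1) q t := by
  have h1 : i < q ^ 2 - 1 := hi.trans (mem_minReps.1 (rep_mem ht)).1
  rw [mem_Delta (by omega)]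
  refine ⟨h1, ?_⟩
  obtain ⟨j, hj, h⟩ := exists_rep_eq (min_mem_minReps h1)
  rw [← h]
  have hlt : rep (q ^ 2 - 1) q j < rep (q ^ 2 - 1) q (t + 1) := by
    rw [h]
    exact (min_le_left _ _).trans_lt hi
  by_contra! hc
  rcases lt_trichotomy j (t + 1) with h' | h' | h'
  · rcases Nat.lt_or_ge j t with h'' | h''
    · exact absurd (rep_lt_rep h'' (Nat.lt_of_succ_lt ht)) (by omega)
    · obtain rfl : j = t := by omega
      exact lt_irrefl _ hc
  · rw [h'] at hlt
    exact lt_irrefl _ hlt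
  · exact absurd (rep_lt_rep h' hj) (by omega)

theorem card_Delta {t : ℕ} (ht : t < (minReps (q ^ 2 - 1) q).card) :
    (Delta (q ^ 2 - 1) q t).card =
      ∑ j ∈ Finset.range (t + 1), (coset (q ^ 2 - 1) q (rep (q ^ 2 - 1) q j)).card := by
  refine Finset.card_biUnion fun i hi j hj hij => Finset.disjoint_left.2 fun x hx hx' => ?_
  rw [Finset.mem_coe, Finset.mem_range] at hi hj
  have h1 := (eq_min_of_mem_coset (rep_mem (by omega)) hx).2
  have h2 := (eq_min_of_mem_coset (rep_mem (by omega)) hx').2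
  rcases lt_or_gt_of_ne hij with h | h
  · exact absurd (rep_lt_rep h (by omega : j < (minReps (q ^ 2 - 1) q).card)) (by omega)
  · exact absurd (rep_lt_rep h (by omega : i < (minReps (q ^ 2 - 1) q).card)) (by omega)

/-- Both digits of q² - 1 are q - 1, so the subtraction needs no borrow. -/
theorem digits_sub {x y : ℕ} (hx : x < q) (hy : y < q) :
    q ^ 2 - 1 - (x + y * q) = (q - 1 - x) + (q - 1 - y) * q := by
  obtain ⟨a, rfl⟩ := Nat.exists_eq_add_of_lt hx
  obtain ⟨b, hb⟩ := Nat.exists_eq_add_of_lt hy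
  rw [show x + a + 1 - 1 - x = a by omega, show x + a + 1 - 1 - y = b by omega]
  have : (x + a + 1) ^ 2 = x + y * (x + a + 1) + (a + b * (x + a + 1)) + 1 := by
    have : (x + a + 1) ^ 2 = (y + b + 1) * (x + a + 1) := by rw [← hb, sq]
    rw [this]
    ring
  omega

theorem sub_mul_mod {i : ℕ} (h : i < q ^ 2 - 1) (h0 : i ≠ 0) :
    (q ^ 2 - 1 - i) * q % (q ^ 2 - 1) = q ^ 2 - 1 - i * q % (q ^ 2 - 1) := by
  obtain ⟨x, hx, y, hy, rfl⟩ := exists_digits h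
  have h' : (q - 1 - x) + (q - 1 - y) * q < q ^ 2 - 1 := by
    rw [← digits_sub hx hy]
    omega
  rw [digits_mul_mod hx hy h, digits_sub hx hy, digits_sub hy hx,
    digits_mul_mod (by omega) (by omega) h']

theorem mul_mod_ne_zero {i : ℕ} (h : i < q ^ 2 - 1) (h0 : i ≠ 0) :
    i * q % (q ^ 2 - 1) ≠ 0 := by
  intro h'
  have := mul_mod_mul_mod h
  rw [h', zero_mul, Nat.zero_mod] at this
  exact h0 this.symm

theorem mul_mod_mem_Delta {t i : ℕ} (ht : t < (minReps (q ^ 2 - 1) q).card)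
    (hi : i ∈ Delta (q ^ 2 - 1) q t) : i * q % (q ^ 2 - 1) ∈ Delta (q ^ 2 - 1) q t := by
  rw [mem_Delta ht] at hi ⊢
  rw [mul_mod_mul_mod hi.1, min_comm]
  exact ⟨mul_mod_lt hi.1, hi.2⟩

theorem pow_mul_card_eq {K : Type*} [Field K] [Fintype K] (hK : Fintype.card K = q ^ 2) {i : ℕ}
    (h : i < q ^ 2 - 1) (P : K) : P ^ (i * q) = P ^ (i * q % (q ^ 2 - 1)) := by
  by_cases hP : P = 0
  · rcases eq_or_ne i 0 with rfl | h0
    · simp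
    · have h2 := mul_mod_ne_zero h h0
      have h1 : i * q ≠ 0 := fun h' => h2 (by rw [h', Nat.zero_mod])
      rw [hP, zero_pow h1, zero_pow h2]
  · conv_lhs => rw [← Nat.mod_add_div (i * q) (q ^ 2 - 1)]
    rw [pow_add, pow_mul, ← hK, FiniteField.pow_card_sub_one_eq_one P hP, one_pow, mul_one]

theorem isFrobeniusStable_Delta {F K : Type*} [Fintype F] [Field K] [Fintype K]
    (hF : Fintype.card F = q) (hK : Fintype.card K = q ^ 2) {t : ℕ}
    (ht : t < (minReps (q ^ 2 - 1) q).card) :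
    IsFrobeniusStable F K (Delta (q ^ 2 - 1) q t) := by
  intro i hi
  exact ⟨_, mul_mod_mem_Delta ht hi, hF ▸ pow_mul_card_eq hK ((mem_Delta ht).1 hi).1⟩

/-- Negation commutes with multiplication by q, so the exponents of the hull are again closed under
Frobenius and the dimension formula applies to them. -/
theorem isFrobeniusStable_filter_Delta {F K : Type*} [Fintype F] [Field K] [Fintype K]
    (hF : Fintype.card F = q) (hK : Fintype.card K = q ^ 2) {t : ℕ}
    (ht : t < (minReps (q ^ 2 - 1) q).card) :
    IsFrobeniusStable F K ((Delta (q ^ 2 - 1) q t).filter fun i =>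
      ¬ (i ≠ 0 ∧ q ^ 2 - 1 - i ∈ Delta (q ^ 2 - 1) q t)) := by
  intro i hi
  rw [Finset.mem_filter] at hi
  have hlt := ((mem_Delta ht).1 hi.1).1
  refine ⟨i * q % (q ^ 2 - 1), Finset.mem_filter.2 ⟨mul_mod_mem_Delta ht hi.1, ?_⟩,
    hF ▸ pow_mul_card_eq hK hlt⟩
  rintro ⟨h0, h⟩
  have hi0 : i ≠ 0 := by
    rintro rfl
    simp at h0
  refine hi.2 ⟨hi0, ?_⟩
  have := mul_mod_mem_Delta ht h
  rwa [sub_mul_mod (mul_mod_lt hlt) h0, mul_mod_mul_mod hlt] at this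

end Cosets

/-! ### Counting digit pairs and the closed formula for c. -/

section Counting

theorem min_digits_le_iff {q x y b₀ b₁ : ℕ} (hx : x < q) (hy : y < q) (hb₀ : b₀ < q) :
    min (x + y * q) (y + x * q) ≤ b₀ + b₁ * q ↔
      min x y < b₁ ∨ min x y = b₁ ∧ max x y ≤ b₀ := by
  have key : ∀ u v, u < q → (u + v * q ≤ b₀ + b₁ * q ↔ v < b₁ ∨ v = b₁ ∧ u ≤ b₀) := by
    intro u v hu
    constructor
    · intro h
      rcases lt_trichotomy v b₁ with h' | rfl | h'
      · exact Or.inl h'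
      · exact Or.inr ⟨rfl, by omega⟩
      · have := Nat.mul_le_mul_right q h'
        rw [Nat.succ_mul] at this
        omega
    · rintro (h | ⟨rfl, h⟩)
      · have := Nat.mul_le_mul_right q h
        rw [Nat.succ_mul] at this
        omega
      · omega
  rw [min_le_iff, key x y hx, key y x hy]
  omega

/-- The elements of `Δ` whose negatives lie in `Δ`, by their digits. -/
theorem card_filter_Delta {q t b₀ b₁ : ℕ} (ht : t < (minReps (q ^ 2 - 1) q).card)
    (hb₀ : b₀ < q) (hm : rep (q ^ 2 - 1) q t = b₀ + b₁ * q) :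
    ((Delta (q ^ 2 - 1) q t).filter fun i => i ≠ 0 ∧ q ^ 2 - 1 - i ∈ Delta (q ^ 2 - 1) q t).card =
      ((Finset.range q ×ˢ Finset.range q).filter fun p =>
        (min p.1 p.2 < b₁ ∨ min p.1 p.2 = b₁ ∧ max p.1 p.2 ≤ b₀) ∧
        (q - 1 - max p.1 p.2 < b₁ ∨ q - 1 - max p.1 p.2 = b₁ ∧ q - 1 - min p.1 p.2 ≤ b₀)).card := by
  have hmem : ∀ x < q, ∀ y < q, x + y * q ∈ Delta (q ^ 2 - 1) q t ↔
      min x y < b₁ ∨ min x y = b₁ ∧ max x y ≤ b₀ := by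
    intro x hx y hy
    rw [mem_Delta ht, hm]
    by_cases h : x + y * q < q ^ 2 - 1
    · rw [digits_mul_mod hx hy h, min_digits_le_iff hx hy hb₀]
      exact and_iff_right h
    · refine iff_of_false (fun h' => h h'.1) fun h' => h ?_
      rw [← min_digits_le_iff hx hy hb₀] at h'
      have hlt : b₀ + b₁ * q < q ^ 2 - 1 := hm ▸ (mem_minReps.1 (rep_mem ht)).1
      rcases min_le_iff.1 h' with h' | h'
      · exact h'.trans_lt hlt
      · exact digits_swap_lt hy hx (h'.trans_lt hlt)
  symm
  refine Finset.card_bij (fun p _ => p.1 + p.2 * q) ?_ ?_ ?_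
  · rintro ⟨x, y⟩ h
    simp only [Finset.mem_filter, Finset.mem_product, Finset.mem_range] at h ⊢
    obtain ⟨⟨hx, hy⟩, h1, h2⟩ := h
    have h3 := (hmem x hx y hy).2 h1
    have h4 : q ^ 2 - 1 - (x + y * q) ∈ Delta (q ^ 2 - 1) q t := by
      rw [digits_sub hx hy, hmem _ (by omega) _ (by omega)]
      omega
    refine ⟨h3, fun h0 => ?_, h4⟩
    rw [h0, mem_Delta ht] at h4
    omega
  · rintro ⟨x, y⟩ h ⟨x', y'⟩ h' heq
    simp only [Finset.mem_filter, Finset.mem_product, Finset.mem_range] at h h'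
    have hx : x = x' := by
      have := congrArg (· % q) heq
      simpa [Nat.mod_eq_of_lt h.1.1, Nat.mod_eq_of_lt h'.1.1] using this
    subst hx
    rw [Prod.mk.injEq]
    exact ⟨rfl, Nat.eq_of_mul_eq_mul_right (by omega) (Nat.add_left_cancel heq)⟩
  · intro i h
    rw [Finset.mem_filter] at h
    obtain ⟨h1, -, h2⟩ := h
    obtain ⟨x, hx, y, hy, rfl⟩ := exists_digits ((mem_Delta ht).1 h1).1
    refine ⟨(x, y), ?_, rfl⟩
    rw [digits_sub hx hy, hmem _ (by omega) _ (by omega)] at h2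
    rw [hmem x hx y hy] at h1
    simp only [Finset.mem_filter, Finset.mem_product, Finset.mem_range]
    refine ⟨⟨hx, hy⟩, h1, ?_⟩
    omega

/-- A symmetric relation holds twice for each unordered pair. -/
theorem card_filter_symm (q : ℕ) (p : ℕ → ℕ → Prop) [DecidableRel p] :
    ((Finset.range q ×ˢ Finset.range q).filter fun z => p (min z.1 z.2) (max z.1 z.2)).card =
      2 * (∑ y ∈ Finset.range q, ((Finset.range q).filter fun x => y < x ∧ p y x).card) +
        ((Finset.range q).filter fun x => p x x).card := by
  simp only [Finset.card_filter, Finset.sum_product, two_mul]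
  have h : ∀ y x, (if p (min y x) (max y x) then 1 else 0) =
      (if y < x ∧ p y x then 1 else 0) + (if x < y ∧ p x y then 1 else 0) +
        if y = x then (if p x x then 1 else 0) else 0 := by
    intro y x
    rcases lt_trichotomy y x with h | rfl | h
    · simp [h.le, h, h.not_gt, h.ne]
    · simp
    · simp [h.le, h, h.not_gt, h.ne']
  simp only [h, Finset.sum_add_distrib]
  congr 1
  · congr 1
    exact Finset.sum_comm
  · refine Finset.sum_congr rfl fun y hy => ?_
    rw [Finset.sum_ite_eq, if_pos hy]

/-- The terms equal b up to y = p - b and then fall short by 1, 2, …; the total deficit is a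
triangular number. -/
theorem two_mul_sum_min (b p k : ℕ) (hk : k ≤ p) (hb : b ≤ p) :
    (2 * ∑ y ∈ Finset.range k, min b (p - y) : ℤ) =
      2 * k * b - max 0 ((k : ℤ) - (p - b)) * (max 0 ((k : ℤ) - (p - b)) - 1) := by
  induction k with
  | zero =>
    rw [max_eq_left (by push_cast; omega)]
    simp
  | succ k ih =>
    rw [Finset.sum_range_succ, Nat.cast_add, mul_add, ih (by omega)]
    push_cast
    rcases le_or_gt ((k : ℤ) + 1) (p - b) with h | h
    · rw [max_eq_left (by omega), max_eq_left (by omega), min_eq_left (by omega)]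
      ring
    · rw [max_eq_right (by omega), max_eq_right (by omega), min_eq_right (by omega),
        Nat.cast_sub (by omega)]
      ring

/-- Rows y < b₁ contain the x ≥ q - b₁ above the diagonal, plus the boundary point x = q - 1 - b₁
when y ≥ q - 1 - b₀ and that point is still above the diagonal. The row y = b₁ gives the last
summand, and higher rows are empty. -/
theorem sum_card_upper {q b₀ b₁ : ℕ} (hb₀ : b₀ < q) (hb : b₁ ≤ b₀) :
    ∑ y ∈ Finset.range q, ((Finset.range q).filter fun x => y < x ∧
      (y < b₁ ∨ y = b₁ ∧ x ≤ b₀) ∧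
        (q - 1 - x < b₁ ∨ q - 1 - x = b₁ ∧ q - 1 - y ≤ b₀)).card =
      ∑ y ∈ Finset.range b₁, min b₁ (q - 1 - y) + (min b₁ (q - 1 - b₁) - (q - 1 - b₀)) +
        (b₀ + 1 - max (b₁ + 1) (q - 1 - b₁)) := by
  have hsub : Finset.range (b₁ + 1) ⊆ Finset.range q := Finset.range_mono (by omega)
  rw [← Finset.sum_subset hsub, Finset.sum_range_succ]
  · congr 1
    · have h1 : min b₁ (q - 1 - b₁) - (q - 1 - b₀) =
          ((Finset.range b₁).filter fun y => q - 1 - b₀ ≤ y ∧ b₁ + y < q - 1).card := by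
        rw [← Nat.card_Ico]
        congr 1
        ext y
        simp only [Finset.mem_Ico, Finset.mem_filter, Finset.mem_range]
        omega
      rw [h1, Finset.card_filter, ← Finset.sum_add_distrib]
      refine Finset.sum_congr rfl fun y hy => ?_
      rw [Finset.mem_range] at hy
      have h2 : ((Finset.range q).filter fun x => y < x ∧ (y < b₁ ∨ y = b₁ ∧ x ≤ b₀) ∧
          (q - 1 - x < b₁ ∨ q - 1 - x = b₁ ∧ q - 1 - y ≤ b₀)) =
            Finset.Ico (max (y + 1) (q - b₁ - if q - 1 - y ≤ b₀ then 1 else 0)) q := by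
        ext x
        simp only [Finset.mem_Ico, Finset.mem_filter, Finset.mem_range]
        split_ifs <;> omega
      rw [h2, Nat.card_Ico]
      split_ifs <;> omega
    · rw [← Nat.card_Ico (max (b₁ + 1) (q - 1 - b₁)) (b₀ + 1)]
      refine congrArg Finset.card ?_
      ext x
      simp only [Finset.mem_Ico, Finset.mem_filter, Finset.mem_range]
      constructor
      · omega
      · rintro ⟨h1, h2⟩
        have := max_le_iff.1 h1
        exact ⟨by omega, by omega, Or.inr ⟨trivial, by omega⟩, by omega⟩
  · intro y _ hy
    rw [Finset.mem_range] at hy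
    rw [Finset.card_eq_zero, Finset.filter_eq_empty_iff]
    intro x _
    omega

theorem card_diagonal {q b₀ b₁ : ℕ} (hb₀ : b₀ < q) (hb : b₁ ≤ b₀) :
    ((Finset.range q).filter fun x => (x < b₁ ∨ x = b₁ ∧ x ≤ b₀) ∧
        (q - 1 - x < b₁ ∨ q - 1 - x = b₁ ∧ q - 1 - x ≤ b₀)).card = 2 * b₁ + 2 - q := by
  have : 2 * b₁ + 2 - q = (Finset.Icc (q - 1 - b₁) b₁).card := by
    rw [Nat.card_Icc]
    omega
  rw [this]
  congr 1
  ext x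
  simp only [Finset.mem_Icc, Finset.mem_filter, Finset.mem_range]
  omega

theorem floor_half (h r : ℤ) (h0 : 0 ≤ r) (h1 : r < 2) : ⌊((2 * h + r : ℤ) : ℚ) / 2⌋ = h := by
  have h0' : (0 : ℚ) ≤ r := by exact_mod_cast h0
  have h1' : (r : ℚ) < 2 := by exact_mod_cast h1
  rw [Int.floor_eq_iff]
  push_cast
  constructor <;> linarith

theorem ceil_half (h r : ℤ) (h0 : 0 ≤ r) (h1 : r < 2) : ⌈((2 * h + r : ℤ) : ℚ) / 2⌉ = h + r := by
  rw [Int.ceil_eq_iff]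
  obtain rfl | rfl : r = 0 ∨ r = 1 := by omega
  all_goals
    push_cast
    constructor <;> linarith

/-- With q = 2h + r, this rewrites the triangular deficit through h = ⌊q/2⌋ and h + r = ⌈q/2⌉,
uniformly in the parity of q. -/
theorem max_mul_max_sub_one (b h r : ℤ) (h0 : 0 ≤ r) (h1 : r < 2) :
    max 0 (b - (2 * h + r - 1 - b)) * (max 0 (b - (2 * h + r - 1 - b)) - 1) =
      4 * (max 0 (b - (h + r)) * (b - h)) + 2 * max 0 (b - h) := by
  rcases lt_trichotomy b h with hb | rfl | hb
  · rw [max_eq_left (b := b - h) (by omega), max_eq_left (b := b - (h + r)) (by omega),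
      max_eq_left (by omega)]
    ring
  · obtain rfl | rfl : r = 0 ∨ r = 1 := by omega
    · rw [max_eq_right (by omega)]
      ring_nf
      simp
    · rw [max_eq_left (by omega)]
      simp
  · rw [max_eq_right (b := b - h) (by omega), max_eq_right (b := b - (h + r)) (by omega),
      max_eq_right (by omega)]
    obtain rfl | rfl : r = 0 ∨ r = 1 := by omega
    all_goals ring

/-- The quadratic quantities enter only as the unknowns T, M and s, so what remains is piecewise
linear, with regimes b₁ ≥ h and b₁ < h. -/
theorem closed_form_arith {q b₀ b₁ T M s h r : ℤ} (hb₀ : b₀ < q) (hb : b₁ ≤ b₀)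
    (hr0 : 0 ≤ r) (hr1 : r < 2) (hq : q = 2 * h + r)
    (hT : 2 * T = 4 * s - 2 * b₁ - (4 * M + 2 * max 0 (b₁ - h))) :
    2 * (T + max 0 (min b₁ (q - 1 - b₁) - (q - 1 - b₀))
        + max 0 (b₀ + 1 - max (b₁ + 1) (q - 1 - b₁))) + max 0 (2 * b₁ + 2 - q) =
      4 * (s - M + max 0 (b₀ - max (q - 1 - b₁) b₁ + 1)) - 3 * (if r = 1 ∧ h ≤ b₁ then 1 else 0)
        - 2 * max 0 (b₁ - (h + r - 1)) - 2 * min (b₁ + if q - 1 ≤ b₀ + b₁ then 1 else 0) h := by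
  subst hq
  rcases le_or_gt h b₁ with h1 | h1
  · rw [max_eq_right (b := b₁ - h) (by omega)] at hT
    rw [min_eq_right (a := b₁) (by omega), max_eq_left (a := b₁ + 1) (by omega),
      max_eq_right (b := b₁) (by omega), max_eq_right (b := 2 * b₁ + 2 - _) (by omega),
      max_eq_right (b := b₁ - (h + r - 1)) (by omega), min_eq_right (by split_ifs <;> omega),
      max_eq_right (b := b₀ + 1 - _) (by omega), max_eq_right (b := b₀ - _ + 1) (by omega),
      max_eq_right (by omega)]
    split_ifs <;> omega
  · rw [max_eq_left (b := b₁ - h) (by omega)] at hT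
    rw [min_eq_left (a := b₁) (by omega), max_eq_right (a := b₁ + 1) (by omega),
      max_eq_left (b := b₁) (by omega), max_eq_left (b := 2 * b₁ + 2 - _) (by omega),
      max_eq_left (b := b₁ - (h + r - 1)) (by omega), min_eq_left (by split_ifs <;> omega),
      if_neg (by omega)]
    split_ifs with h2
    · rw [max_eq_right (by omega), max_eq_right (by omega), max_eq_right (by omega)]
      omega
    · rw [max_eq_left (by omega), max_eq_left (by omega), max_eq_left (by omega)]
      omega

/-- The number of entangled pairs in closed form. -/
theorem card_filter_Delta_eq {q t b₀ b₁ : ℕ} (ht : t < (minReps (q ^ 2 - 1) q).card)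
    (hb₀ : b₀ < q) (hb₁ : b₁ < q) (hm : rep (q ^ 2 - 1) q t = b₀ + b₁ * q) (δ : ℤ)
    (hδ : δ = if Odd q ∧ ((q : ℚ) ^ 2 - 1) / 2 ≤ (rep (q ^ 2 - 1) q t : ℚ) then 1 else 0) :
    (((Delta (q ^ 2 - 1) q t).filter fun i =>
      i ≠ 0 ∧ q ^ 2 - 1 - i ∈ Delta (q ^ 2 - 1) q t).card : ℤ) =
        4 * ((b₁ : ℤ) * (b₁ + 1) / 2
              - max 0 ((b₁ : ℤ) - ⌈(q : ℚ) / 2⌉) * ((b₁ : ℤ) - ⌊(q : ℚ) / 2⌋)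
              + max 0 ((b₀ : ℤ) - max ((q : ℤ) - 1 - b₁) (b₁ : ℤ) + 1))
          - 3 * δ
          - 2 * max 0 (⌊(rep (q ^ 2 - 1) q t : ℚ) / ((q : ℚ) + 1)⌋ - ⌊((q : ℚ) - 1) / 2⌋)
          - 2 * min ⌊(rep (q ^ 2 - 1) q t : ℚ) / ((q : ℚ) - 1)⌋ ⌊(q : ℚ) / 2⌋ := by
  have hrep := mem_minReps.1 (rep_mem ht)
  rw [hm] at hrep
  -- Minimality of m_t in its coset orders its digits; with m_t < q² - 1 this also excludes b₁ = q -
  -- 1.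
  have hb : b₁ ≤ b₀ := by
    have h := hrep.2
    rw [digits_mul_mod hb₀ hb₁ hrep.1] at h
    by_contra! hc
    nlinarith
  have hbb : b₁ + 2 ≤ q := by
    by_contra! hc
    obtain rfl : b₀ = b₁ := by omega
    obtain rfl : q = b₀ + 1 := by omega
    have h := hrep.1
    have : (b₀ + 1) ^ 2 = b₀ + b₀ * (b₀ + 1) + 1 := by ring
    omega
  have hq2 : 2 ≤ q := by omega
  have e1 : ((q - 1 - b₁ : ℕ) : ℤ) = q - 1 - b₁ := by omega
  have e2 : ((q - 1 - b₀ : ℕ) : ℤ) = q - 1 - b₀ := by omega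
  obtain ⟨h, r, hr0, hr1, hqhr⟩ : ∃ h r : ℤ, 0 ≤ r ∧ r < 2 ∧ (q : ℤ) = 2 * h + r :=
    ⟨q / 2, q % 2, by omega, by omega, by omega⟩
  have hqQ : (q : ℚ) = ((2 * h + r : ℤ) : ℚ) := by rw [← hqhr, Int.cast_natCast]
  have hf1 : ⌊(q : ℚ) / 2⌋ = h := by rw [hqQ, floor_half h r hr0 hr1]
  have hc1 : ⌈(q : ℚ) / 2⌉ = h + r := by rw [hqQ, ceil_half h r hr0 hr1]
  have hf2 : ⌊((q : ℚ) - 1) / 2⌋ = h + r - 1 := by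
    have : (q : ℚ) - 1 = ((2 * (h + r - 1) + (1 - r) : ℤ) : ℚ) := by
      rw [hqQ]
      push_cast
      ring
    rw [this, floor_half _ _ (by omega) (by omega)]
  have hq2' : (2 : ℚ) ≤ q := by exact_mod_cast hq2
  have hb₀' : (b₀ : ℚ) + 1 ≤ q := by exact_mod_cast hb₀
  have hb' : (b₁ : ℚ) ≤ b₀ := by exact_mod_cast hb
  have hbb' : (b₁ : ℚ) + 2 ≤ q := by exact_mod_cast hbb
  -- m_t = b₁(q + 1) + (b₀ - b₁), with 0 ≤ b₀ - b₁ < q + 1.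
  have hf3 : ⌊((b₀ + b₁ * q : ℕ) : ℚ) / ((q : ℚ) + 1)⌋ = b₁ := by
    rw [Int.floor_eq_iff, le_div_iff₀ (by linarith), div_lt_iff₀ (by linarith)]
    push_cast
    have h0 : (0 : ℚ) ≤ b₁ := Nat.cast_nonneg _
    constructor <;> linarith
  -- m_t = b₁(q - 1) + (b₀ + b₁), and b₀ + b₁ < 2(q - 1), so the quotient exceeds b₁ by at most one.
  have hf4 : ⌊((b₀ + b₁ * q : ℕ) : ℚ) / ((q : ℚ) - 1)⌋ =
      b₁ + if (q : ℤ) - 1 ≤ b₀ + b₁ then 1 else 0 := by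
    rw [Int.floor_eq_iff, le_div_iff₀ (by linarith), div_lt_iff₀ (by linarith)]
    split_ifs with hif
    · have : (q : ℚ) - 1 ≤ b₀ + b₁ := by exact_mod_cast hif
      push_cast
      constructor <;> linarith
    · have : (b₀ : ℚ) + b₁ < q - 1 := by exact_mod_cast not_le.1 hif
      have h0 : (0 : ℚ) ≤ b₁ := Nat.cast_nonneg _
      push_cast
      constructor <;> linarith
  -- For q = 2h + 1 both digits of (q² - 1)/2 are h; as b₁ ≤ b₀, comparing leading digits suffices.
  have hδ' : δ = if r = 1 ∧ h ≤ b₁ then 1 else 0 := by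
    rw [hδ, hm]
    refine if_congr ?_ rfl rfl
    have hodd : Odd q ↔ r = 1 := by
      rw [Nat.odd_iff]
      omega
    rw [hodd]
    refine and_congr_right fun hr => ?_
    subst hr
    have hiff : (((q : ℚ) ^ 2 - 1) / 2 ≤ ((b₀ + b₁ * q : ℕ) : ℚ)) ↔
        (q : ℤ) ^ 2 - 1 ≤ 2 * (b₀ + b₁ * q) := by
      rw [div_le_iff₀ two_pos, ← Int.cast_le (R := ℚ)]
      push_cast
      rw [mul_comm]
    rw [hiff, hqhr]
    have hb₀h : (b₀ : ℤ) < 2 * h + 1 := by omega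
    constructor
    · intro h1
      by_contra! hc
      have h2 : 0 ≤ (h - 1 - b₁) * (2 * h + 1) := mul_nonneg (by omega) (by omega)
      linarith
    · intro h1
      have hb0 : h ≤ b₀ := by omega
      have h2 : 0 ≤ (b₁ - h) * (2 * h + 1) := mul_nonneg (by omega) (by omega)
      linarith
  have hM : max 0 ((b₁ : ℤ) - ((q - 1 : ℕ) - b₁)) * (max 0 ((b₁ : ℤ) - ((q - 1 : ℕ) - b₁)) - 1) =
      4 * (max 0 ((b₁ : ℤ) - (h + r)) * (b₁ - h)) + 2 * max 0 (b₁ - h) := by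
    rw [show ((q - 1 : ℕ) : ℤ) = 2 * h + r - 1 by omega]
    exact max_mul_max_sub_one _ h r hr0 hr1
  obtain ⟨s, hs⟩ : ∃ s, (b₁ : ℤ) * (b₁ + 1) = 2 * s := by
    obtain ⟨s, hs⟩ := Int.even_mul_succ_self (b₁ : ℤ)
    exact ⟨s, by rw [hs]; ring⟩
  have hcount : ((Delta (q ^ 2 - 1) q t).filter fun i =>
      i ≠ 0 ∧ q ^ 2 - 1 - i ∈ Delta (q ^ 2 - 1) q t).card =
        2 * (∑ y ∈ Finset.range b₁, min b₁ (q - 1 - y) + (min b₁ (q - 1 - b₁) - (q - 1 - b₀)) +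
        (b₀ + 1 - max (b₁ + 1) (q - 1 - b₁))) + (2 * b₁ + 2 - q) := by
    rw [card_filter_Delta ht hb₀ hm, ← sum_card_upper hb₀ hb, ← card_diagonal hb₀ hb]
    exact card_filter_symm q fun u v => (u < b₁ ∨ u = b₁ ∧ v ≤ b₀) ∧
        (q - 1 - v < b₁ ∨ q - 1 - v = b₁ ∧ q - 1 - u ≤ b₀)
  have hT := two_mul_sum_min b₁ (q - 1) b₁ (by omega) (by omega)
  rw [hM] at hT
  rw [hcount, hm]
  rw [hf1, hc1, hf2, hf3, hf4, hδ', hs, Int.mul_ediv_cancel_left s two_ne_zero]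
  have hs' : 2 * (b₁ : ℤ) * b₁ = 4 * s - 2 * b₁ := by linear_combination 2 * hs
  rw [hs'] at hT
  generalize max 0 ((b₁ : ℤ) - (h + r)) * (b₁ - h) = M at hT ⊢
  generalize ∑ y ∈ Finset.range b₁, min b₁ (q - 1 - y) = T at hT ⊢
  rw [← closed_form_arith (by omega) (by omega) hr0 hr1 hqhr hT]
  have e (u v : ℕ) : ((u - v : ℕ) : ℤ) = max 0 ((u : ℤ) - v) := by
    rcases le_total u v with h | h
    · rw [Nat.sub_eq_zero_of_le h, max_eq_left (by omega)]; rfl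
    · rw [Nat.cast_sub h, max_eq_right (by omega)]
  simp only [Nat.cast_add, Nat.cast_mul, e (min _ _), e (b₀ + 1), e (2 * b₁ + 2), Nat.cast_min,
    Nat.cast_max, e1, e2, Nat.cast_one, Nat.cast_ofNat]

end Counting

end EABCH

/-! ### Assembly of the parameters. -/

theorem mainTheorem4 (F K : Type*) [Field F] [Fintype F] [DecidableEq F]
    [Field K] [Fintype K] [DecidableEq K] [Algebra F K]
    (q : ℕ) (hq : Fintype.card F = q) (hFK : Module.finrank F K = 2)
    (t : ℕ) (ht : t + 1 < (EABCH.minReps (q ^ 2 - 1) q).card)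
    (b₀ b₁ : ℕ) (hb₀ : b₀ < q) (hb₁ : b₁ < q)
    (hm : EABCH.rep (q ^ 2 - 1) q t = b₀ + b₁ * q)
    (δ : ℤ)
    (hδ : δ = if Odd q ∧ ((q : ℚ) ^ 2 - 1) / 2 ≤ (EABCH.rep (q ^ 2 - 1) q t : ℚ) then 1 else 0) :
    ∃ k c : ℕ,
      (k : ℤ) = (q : ℤ) ^ 2
        - 2 * ∑ j ∈ Finset.range (t + 1),
            ((EABCH.coset (q ^ 2 - 1) q (EABCH.rep (q ^ 2 - 1) q j)).card : ℤ) + (c : ℤ) ∧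
      (c : ℤ) =
        4 * ((b₁ : ℤ) * (b₁ + 1) / 2
              - max 0 ((b₁ : ℤ) - ⌈(q : ℚ) / 2⌉) * ((b₁ : ℤ) - ⌊(q : ℚ) / 2⌋)
              + max 0 ((b₀ : ℤ) - max ((q : ℤ) - 1 - b₁) (b₁ : ℤ) + 1))
          - 3 * δ
          - 2 * max 0 (⌊(EABCH.rep (q ^ 2 - 1) q t : ℚ) / ((q : ℚ) + 1)⌋ - ⌊((q : ℚ) - 1) / 2⌋)
          - 2 * min ⌊(EABCH.rep (q ^ 2 - 1) q t : ℚ) / ((q : ℚ) - 1)⌋ ⌊(q : ℚ) / 2⌋ ∧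
      Fintype.card K = q ^ 2 ∧
      (let E : Submodule F (K → F) := EABCH.bchCode F K (EABCH.Delta (q ^ 2 - 1) q t)
       let C : Submodule F (K → F) := EABCH.dualCode E
       Module.finrank F E
          = ∑ j ∈ Finset.range (t + 1),
              (EABCH.coset (q ^ 2 - 1) q (EABCH.rep (q ^ 2 - 1) q j)).card ∧
       (c : ℤ) = (Module.finrank F E : ℤ) - (Module.finrank F (E ⊓ C : Submodule F (K → F)) : ℤ) ∧
       (∀ y ∈ C, y ≠ 0 → EABCH.rep (q ^ 2 - 1) q (t + 1) + 1 ≤ hammingNorm y) ∧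
       ∃ Q : EABCH.EACode F K k c, Q.IsStabilizerCodeOf E ∧
         Q.MinDistGE (EABCH.rep (q ^ 2 - 1) q (t + 1) + 1)) := by
  have hK : Fintype.card K = q ^ 2 := hq ▸ EABCH.card_eq_sq hFK
  have ht' : t < (EABCH.minReps (q ^ 2 - 1) q).card := Nat.lt_of_succ_lt ht
  have hstab := EABCH.isFrobeniusStable_Delta (F := F) hq hK ht'
  have hlt : ∀ i ∈ EABCH.Delta (q ^ 2 - 1) q t, i < Fintype.card K - 1 := fun i hi =>
    hK ▸ ((EABCH.mem_Delta ht').1 hi).1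
  have hdim : Module.finrank F (EABCH.bchCode F K (EABCH.Delta (q ^ 2 - 1) q t)) =
      (EABCH.Delta (q ^ 2 - 1) q t).card :=
    EABCH.finrank_bchCode hFK (fun i hi => (hlt i hi).trans_le (Nat.sub_le _ _)) hstab
  have hhull := EABCH.bchCode_inf_dualCode hFK hlt hstab
  rw [hK] at hhull
  have hhdim := EABCH.finrank_bchCode hFK
    (fun i hi => (hlt i (Finset.mem_filter.1 hi).1).trans_le (Nat.sub_le _ _))
    (EABCH.isFrobeniusStable_filter_Delta (F := F) hq hK ht')
  rw [← hhull] at hhdim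
  have hsplit := Finset.card_filter_add_card_filter_not (s := EABCH.Delta (q ^ 2 - 1) q t)
    (fun i => i ≠ 0 ∧ q ^ 2 - 1 - i ∈ EABCH.Delta (q ^ 2 - 1) q t)
  have hcount := EABCH.card_filter_Delta_eq ht' hb₀ hb₁ hm δ hδ
  set E : Submodule F (K → F) := EABCH.bchCode F K (EABCH.Delta (q ^ 2 - 1) q t) with hE
  set c : ℕ := ((EABCH.Delta (q ^ 2 - 1) q t).filter fun i =>
    i ≠ 0 ∧ q ^ 2 - 1 - i ∈ EABCH.Delta (q ^ 2 - 1) q t).card with hc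
  have hc' : Module.finrank F (E ⊓ EABCH.dualCode E : Submodule F (K → F)) + c
      = Module.finrank F E := by omega
  -- E lies in the dual of its hull, which has dimension q² + c - dim E. Hence the natural
  -- subtraction defining k does not truncate.
  have hle : 2 * Module.finrank F E ≤ q ^ 2 + c := by
    have h1 := EABCH.finrank_add_finrank_dualCode (E ⊓ EABCH.dualCode E)
    have h2 : Module.finrank F E ≤
        Module.finrank F (EABCH.dualCode (E ⊓ EABCH.dualCode E)) := by
      refine Submodule.finrank_mono fun x hx r hr => ?_
      exact (dotProduct_comm r x).trans (hr.2 x hx)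
    omega
  have hweight : ∀ y ∈ EABCH.dualCode E, y ≠ 0 →
      EABCH.rep (q ^ 2 - 1) q (t + 1) + 1 ≤ hammingNorm y := fun y hy hy0 =>
    EABCH.lt_hammingNorm_of_mem_dualCode hFK hstab (fun i hi => EABCH.mem_Delta_of_lt ht hi) hy hy0
  have hcard := EABCH.card_Delta ht'
  refine ⟨q ^ 2 + c - 2 * Module.finrank F E, c, ?_, hcount, hK, hdim.trans hcard, ?_, hweight,
    EABCH.exists_stabilizerCode E hc' (by omega) hweight⟩
  · rw [Nat.cast_sub hle, hdim, hcard]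
    push_cast
    ring
  · omega
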